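/- Let $E$ be a locally compact Hausdorff space with a countable base, with its Borel $\sigma$-algebra. Let $(\hat P_t)_{t\ge 0}$ be an honest Feller–Dynkin semigroup on $C_0(E)$, i.e. a strongly continuous semigroup of bounded linear operators with $\hat P_0=I$ such that $0\le f\le 1$ implies $0\le \hat P_tf\le 1$, and whose representing kernels $P_t(x,\cdot)$, defined by $\hat P_tf(x)=\int f(y)\,P_t(x,dy)$, satisfy $P_t(x,E)=1$ for all $t\ge 0$, $x\in E$. Suppose the associated process is a diffusion: with $\Omega$ the (Polish) space of continuous maps $\omega:[0,\infty)\to E$ under the topology of uniform convergence on compact sets, there are, for $x\in E$, probability measures $\mathbb P^x$ on $(\Omega,\sigma(\omega\mapsto\omega(t):t\ge 0))$ such that for all $n\ge 0$, $0<t_1<\dots<t_n$ and Borel sets $C_0,\dots,C_n\subseteq E$, $$\mathbb P^x\big(\omega(0)\in C_0,\ \omega(t_1)\in C_1,\dots,\omega(t_n)\in C_n\big)=\mathbf 1_{C_0}(x)\int_{C_1}P_{t_1}(x,dx_1)\int_{C_2}P_{t_2-t_1}(x_1,dx_2)\cdots\int_{C_n}P_{t_n-t_{n-1}}(x_{n-1},dx_n),$$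 and $x\mapsto\mathbb P^x$ is continuous for the weak convergence of probability measures. Let $obs:E\to[0,1]$ be continuous and let $0<c<1$. For a pseudometric $m$ on $E$ with values in $[0,1]$ put $U_c(m)(\omega,\omega')=\sup_{t\ge 0}c^t\,m(\omega(t),\omega'(t))$ for $\omega,\omega'\in\Omega$, and $\mathcal G_c(m)(x,y)=\inf_{\gamma}\int U_c(m)\,d\gamma$, the infimum being over all couplings $\gamma$ of $\mathbb P^x$ and $\mathbb P^y$. Let $d^c_0(x,y)=|obs(x)-obs(y)|$, $d^c_{n+1}=\mathcal G_c(d^c_n)$ for $n\ge 0$, and $\overline d^c=\sup_{n\in\mathbb N}d^c_n$. Let the expressions $\mathcal L_\sigma$ and $\mathcal L_\tau$ be generated by $$f\in\mathcal L_\sigma ::= q\mid obs\mid 1-f\mid \textstyle\int g,\qquad g\in\mathcal L_\tau ::= f\circ ev_t\mid \min\{g_1,g_2\}\mid\max\{g_1,g_2\}\mid g\ominus q\mid g\oplus q,$$ with $q\in\mathbb Q\cap[0,1]$ and $t\in\mathbb Q_{\ge 0}$, interpreted as functions $E\to[0,1]$ and $\Omega\to[0,1]$ respectively: $q$, $obs$,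 $1-f$, $\min$ and $\max$ have their obvious meaning, $(\int g)(x)=\int g\,d\mathbb P^x$, $(f\circ ev_t)(\omega)=c^tf(\omega(t))$, $(g\ominus q)(\omega)=\max\{0,g(\omega)-q\}$ and $(g\oplus q)(\omega)=\min\{1,g(\omega)+q\}$. Let $\ell^c(x,y)=\sup_{f\in\mathcal L_\sigma}|f(x)-f(y)|$. Theorem. Every $d^c_n$ is a continuous pseudometric on $E$ with values in $[0,1]$ (so that $\overline d^c$ is well defined), and the two pseudometrics $\ell^c$ and $\overline d^c$ are equal: $\ell^c(x,y)=\overline d^c(x,y)$ for all $x,y\in E$. -/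

import Mathlib

open MeasureTheory Filter Topology
open scoped NNReal ENNReal ZeroAtInfty CompactlySupported

namespace TrajMetric

universe u

/-! ### Trajectories -/

/-- Continuous trajectories `[0, ∞) → E`, with the topology of locally uniform convergence
(the compact-open topology). -/
abbrev Traj (E : Type u) [TopologicalSpace E] : Type u := C(ℝ≥0, E)

/-- The σ-algebra on trajectories generated by the coordinate maps `ω ↦ ω t`. -/
instance Traj.instMeasurableSpace (E : Type u) [TopologicalSpace E] [m : MeasurableSpace E] :
    MeasurableSpace (Traj E) :=
  ⨆ t : ℝ≥0, m.comap (fun ω : Traj E => ω t)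

section TrajBorel

variable {E : Type u} [TopologicalSpace E] [MeasurableSpace E]

theorem Traj.measurable_eval (t : ℝ≥0) : Measurable (fun ω : Traj E => ω t) :=
  Measurable.of_comap_le (le_iSup (fun t : ℝ≥0 => MeasurableSpace.comap
    (fun ω : Traj E => ω t) inferInstance) t)

/-- The σ-algebra generated by the coordinate maps is the Borel σ-algebra. -/
instance Traj.instBorelSpace [LocallyCompactSpace E] [T2Space E] [SecondCountableTopology E]
    [BorelSpace E] : BorelSpace (Traj E) := by
  refine ⟨le_antisymm ?_ ?_⟩
  · refine iSup_le fun t => ?_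
    have h : @Measurable _ _ (borel (Traj E)) _ (fun ω : Traj E => ω t) := by
      let _ : MeasurableSpace (Traj E) := borel _
      have _ : BorelSpace (Traj E) := ⟨rfl⟩
      exact (continuous_eval_const t).measurable
    exact h.comap_le
  · rw [borel_eq_generateFrom_of_subbasis (ContinuousMap.compactOpen_eq (X := ℝ≥0) (Y := E))]
    refine MeasurableSpace.generateFrom_le ?_
    rintro _ ⟨K, hK, U, hU, rfl⟩
    let _ : MetricSpace E := TopologicalSpace.metrizableSpaceMetric E
    obtain ⟨D, hDc, hDd⟩ := TopologicalSpace.exists_countable_dense K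
    have key : {ω : Traj E | Set.MapsTo ω K U} =
        ⋃ n : ℕ, ⋂ d ∈ D, {ω : Traj E | ω d ∈ (Metric.thickening (1 / ((n : ℝ) + 1)) Uᶜ)ᶜ} := by
      ext ω
      simp only [Set.mem_ofPred_eq, Set.mem_iUnion, Set.mem_iInter]
      constructor
      · intro h
        obtain ⟨δ, hδ, hsub⟩ := (hK.image ω.continuous).exists_thickening_subset_open hU
          h.image_subset
        obtain ⟨n, hn⟩ := exists_nat_one_div_lt hδ
        refine ⟨n, fun d _ hd => ?_⟩
        obtain ⟨z, hz, hdz⟩ := Metric.mem_thickening_iff.1 hd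
        refine hz (hsub (Metric.mem_thickening_iff.2 ⟨ω d, ⟨d, d.2, rfl⟩, ?_⟩))
        rw [dist_comm]
        exact hdz.trans hn
      · rintro ⟨n, hn⟩ s hs
        have hcl : IsClosed {s : K | ω s ∈ (Metric.thickening (1 / ((n : ℝ) + 1)) Uᶜ)ᶜ} :=
          (Metric.isOpen_thickening.isClosed_compl).preimage
            (ω.continuous.comp continuous_subtype_val)
        have hall : (⟨s, hs⟩ : K) ∈
            {s : K | ω s ∈ (Metric.thickening (1 / ((n : ℝ) + 1)) Uᶜ)ᶜ} :=
          (hcl.closure_subset_iff.2 fun d hd => hn d hd) (hDd ⟨s, hs⟩)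
        by_contra hU'
        exact hall (Metric.self_subset_thickening (by positivity) _ hU')
    change MeasurableSet {ω : Traj E | Set.MapsTo ω K U}
    rw [key]
    exact MeasurableSet.iUnion fun n => MeasurableSet.biInter hDc fun d _ =>
      Traj.measurable_eval _ Metric.isOpen_thickening.isClosed_compl.measurableSet

end TrajBorel

/-! ### Feller-Dynkin semigroups and diffusions -/

/-- A Feller-Dynkin semigroup: a strongly continuous semigroup of bounded operators on `C₀(E)`
such that `0 ≤ f ≤ 1` implies `0 ≤ P̂ₜ f ≤ 1`. -/
structure FDSemigroup (E : Type u) [TopologicalSpace E] where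
  op : ℝ≥0 → C₀(E, ℝ) →L[ℝ] C₀(E, ℝ)
  op_comp : ∀ s t, (op s).comp (op t) = op (s + t)
  op_zero : op 0 = ContinuousLinearMap.id ℝ C₀(E, ℝ)
  strongly_continuous : ∀ f, Tendsto (fun t => ‖op t f - f‖) (𝓝[>] 0) (𝓝 0)
  sub_markov : ∀ t (f : C₀(E, ℝ)), (∀ x, 0 ≤ f x ∧ f x ≤ 1) → ∀ x, 0 ≤ op t f x ∧ op t f x ≤ 1

namespace FDSemigroup

variable {E : Type u} [TopologicalSpace E]

theorem op_nonneg (S : FDSemigroup E) (t : ℝ≥0) (f : C₀(E, ℝ)) (hf : ∀ x, 0 ≤ f x) (x : E) :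
    0 ≤ S.op t f x := by
  have hpos : (0 : ℝ) < ‖f‖ + 1 := by positivity
  have hle : ∀ y, f y ≤ ‖f‖ := fun y =>
    (le_abs_self _).trans (f.toBCF.norm_coe_le_norm y)
  have h := (S.sub_markov t ((‖f‖ + 1)⁻¹ • f) (fun y => ⟨by
    simpa using mul_nonneg (inv_nonneg.2 hpos.le) (hf y), by
    simp only [ZeroAtInftyContinuousMap.smul_apply, smul_eq_mul]
    rw [inv_mul_le_iff₀ hpos]
    linarith [hle y]⟩) x).1
  simp only [map_smul, ZeroAtInftyContinuousMap.smul_apply, smul_eq_mul] at h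
  exact nonneg_of_mul_nonneg_right h (inv_pos.2 hpos)

/-- The positive functional `f ↦ (P̂ₜ f)(x)` on compactly supported continuous functions. -/
noncomputable def functional (S : FDSemigroup E) (t : ℝ≥0) (x : E) : C_c(E, ℝ) →ₚ[ℝ] ℝ :=
  PositiveLinearMap.mk₀
    { toFun := fun f => S.op t (f : C₀(E, ℝ)) x
      map_add' := fun f g => by
        have h : ((f + g : C_c(E, ℝ)) : C₀(E, ℝ)) = (f : C₀(E, ℝ)) + (g : C₀(E, ℝ)) := rfl
        rw [h, map_add]
        rfl
      map_smul' := fun a f => by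
        have h : ((a • f : C_c(E, ℝ)) : C₀(E, ℝ)) = a • (f : C₀(E, ℝ)) := rfl
        rw [h, map_smul]
        rfl }
    (fun f hf => S.op_nonneg t (f : C₀(E, ℝ)) (fun y => hf y) x)

variable [LocallyCompactSpace E] [T2Space E] [MeasurableSpace E] [BorelSpace E]

/-- The transition measure `Pₜ(x, ·)`: the measure that represents `f ↦ (P̂ₜ f)(x)` in the Riesz
representation theorem. -/
noncomputable def transition (S : FDSemigroup E) (t : ℝ≥0) (x : E) : Measure E :=
  RealRMK.rieszMeasure (S.functional t x)

theorem integral_transition (S : FDSemigroup E) (t : ℝ≥0) (x : E) (f : C_c(E, ℝ)) :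
    ∫ y, f y ∂(S.transition t x) = S.op t (f : C₀(E, ℝ)) x :=
  RealRMK.integral_rieszMeasure (S.functional t x) f

/-- The semigroup is honest if no mass is lost. -/
def IsHonest (S : FDSemigroup E) : Prop := ∀ t x, S.transition t x Set.univ = 1

/-- For a list `(t₁, C₁), …, (tₙ, Cₙ)` with `s < t₁ < ⋯ < tₙ`, the iterated integral
`∫_{C₁} P_{t₁ - s}(x, dx₁) ∫_{C₂} P_{t₂ - t₁}(x₁, dx₂) ⋯ ∫_{Cₙ} P_{tₙ - tₙ₋₁}(xₙ₋₁, dxₙ)`. -/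
noncomputable def cylinderMass (S : FDSemigroup E) : ℝ≥0 → List (ℝ≥0 × Set E) → E → ℝ≥0∞
  | _, [], _ => 1
  | s, (t, C) :: l, x => ∫⁻ y in C, S.cylinderMass t l y ∂(S.transition (t - s) x)

end FDSemigroup

/-- A diffusion: an honest Feller-Dynkin process with continuous trajectories.  The measure `law x`
is the law of the process started at `x`, i.e. the probability measure on trajectories whose
finite-dimensional distributions are those given by the semigroup and the initial distribution
`δₓ`; it depends weakly continuously on `x`. -/
structure Diffusion (E : Type u) [TopologicalSpace E] [LocallyCompactSpace E] [T2Space E]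
    [SecondCountableTopology E] [MeasurableSpace E] [BorelSpace E] extends FDSemigroup E where
  honest : toFDSemigroup.IsHonest
  law : E → ProbabilityMeasure (Traj E)
  law_cylinder : ∀ (x : E) (C₀ : Set E) (l : List (ℝ≥0 × Set E)), MeasurableSet C₀ →
    (∀ p ∈ l, 0 < p.1 ∧ MeasurableSet p.2) → l.Pairwise (fun p q => p.1 < q.1) →
    (law x : Measure (Traj E)) {ω | ω 0 ∈ C₀ ∧ ∀ p ∈ l, ω p.1 ∈ p.2} =
      C₀.indicator (toFDSemigroup.cylinderMass 0 l) x
  continuous_law : Continuous law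

/-! ### Pseudometrics and optimal transport -/

/-- 1-bounded pseudometrics. -/
structure IsPseudometric {X : Type u} (m : X → X → ℝ) : Prop where
  nonneg : ∀ x y, 0 ≤ m x y
  le_one : ∀ x y, m x y ≤ 1
  self : ∀ x, m x x = 0
  symm : ∀ x y, m x y = m y x
  triangle : ∀ x y z, m x z ≤ m x y + m y z

/-- The couplings of `μ` and `ν`: measures on the product with marginals `μ` and `ν`. -/
def couplings {X : Type u} [MeasurableSpace X] (μ ν : ProbabilityMeasure X) :
    Set (ProbabilityMeasure (X × X)) :=
  {γ | (γ : Measure (X × X)).map Prod.fst = μ ∧ (γ : Measure (X × X)).map Prod.snd = ν}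

/-- The optimal transport cost `W(k)(μ, ν)` for the cost function `k`. -/
noncomputable def transportCost {X : Type u} [MeasurableSpace X] (k : X → X → ℝ)
    (μ ν : ProbabilityMeasure X) : ℝ :=
  ⨅ γ : couplings μ ν, ∫ p, k p.1 p.2 ∂((γ : ProbabilityMeasure (X × X)) : Measure (X × X))

/-- The discounted uniform pseudometric `U_c(m)(ω, ω') = sup_t c^t m(ω(t), ω'(t))`. -/
noncomputable def discUnif {E : Type u} [TopologicalSpace E] (c : ℝ) (m : E → E → ℝ)
    (ω ω' : Traj E) : ℝ :=
  ⨆ t : ℝ≥0, c ^ (t : ℝ) * m (ω t) (ω' t)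

/-! ### The logic -/

/-- The two sorts of expressions: those on states and those on trajectories. -/
inductive LogicSort : Type
  | state : LogicSort
  | traj : LogicSort

/-- The expressions of the logic: `LogicExpr .state` is `𝓛_σ` and `LogicExpr .traj` is `𝓛_τ`. -/
inductive LogicExpr : LogicSort → Type
  | const (q : Set.Icc (0 : ℚ) 1) : LogicExpr .state
  | obs : LogicExpr .state
  | compl (f : LogicExpr .state) : LogicExpr .state
  | integral (g : LogicExpr .traj) : LogicExpr .state
  | ev (f : LogicExpr .state) (t : ℚ≥0) : LogicExpr .traj
  | min (g₁ g₂ : LogicExpr .traj) : LogicExpr .traj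
  | max (g₁ g₂ : LogicExpr .traj) : LogicExpr .traj
  | minus (g : LogicExpr .traj) (q : Set.Icc (0 : ℚ) 1) : LogicExpr .traj
  | plus (g : LogicExpr .traj) (q : Set.Icc (0 : ℚ) 1) : LogicExpr .traj

/-- The domain on which the expressions of a given sort are interpreted. -/
abbrev Domain (E : Type u) [TopologicalSpace E] : LogicSort → Type u
  | .state => E
  | .traj => Traj E

namespace Diffusion

variable {E : Type u} [TopologicalSpace E] [LocallyCompactSpace E] [T2Space E]
  [SecondCountableTopology E] [MeasurableSpace E] [BorelSpace E]

/-- The functional `𝓖_c(m)(x, y) = W(U_c(m))(ℙˣ, ℙʸ)`. -/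
noncomputable def functionalG (D : Diffusion E) (c : ℝ) (m : E → E → ℝ) (x y : E) : ℝ :=
  transportCost (discUnif c m) (D.law x) (D.law y)

/-- The iterates `d₀(x, y) = |obs(x) - obs(y)|` and `dₙ₊₁ = 𝓖_c(dₙ)`. -/
noncomputable def iterDist (D : Diffusion E) (obs : E → ℝ) (c : ℝ) : ℕ → E → E → ℝ
  | 0 => fun x y => |obs x - obs y|
  | n + 1 => D.functionalG c (D.iterDist obs c n)

/-- The pseudometric `supₙ dₙ`. -/
noncomputable def fixDist (D : Diffusion E) (obs : E → ℝ) (c : ℝ) (x y : E) : ℝ :=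
  ⨆ n : ℕ, D.iterDist obs c n x y

/-- The interpretation of expressions as functions on states, resp. on trajectories. -/
noncomputable def interp (D : Diffusion E) (obs : E → ℝ) (c : ℝ) :
    {k : LogicSort} → LogicExpr k → Domain E k → ℝ
  | _, .const q => fun _ => ((q : ℚ) : ℝ)
  | _, .obs => fun x => obs x
  | _, .compl f => fun x => 1 - D.interp obs c f x
  | _, .integral g => fun x => ∫ ω, D.interp obs c g ω ∂(D.law x : Measure (Traj E))
  | _, .ev f t => fun ω => c ^ (t : ℝ) * D.interp obs c f (ω (t : ℝ≥0))
  | _, .min g₁ g₂ => fun ω => min (D.interp obs c g₁ ω) (D.interp obs c g₂ ω)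
  | _, .max g₁ g₂ => fun ω => max (D.interp obs c g₁ ω) (D.interp obs c g₂ ω)
  | _, .minus g q => fun ω => max 0 (D.interp obs c g ω - ((q : ℚ) : ℝ))
  | _, .plus g q => fun ω => min 1 (D.interp obs c g ω + ((q : ℚ) : ℝ))

/-- Expressions are interpreted as continuous functions with values in `[0, 1]`. -/
theorem interp_wellDefined (D : Diffusion E) (obs : E → ℝ) (hobs : Continuous obs)
    (hobs01 : ∀ x, 0 ≤ obs x ∧ obs x ≤ 1) (c : ℝ) (hc0 : 0 < c) (hc1 : c < 1) :
    ∀ {k : LogicSort} (e : LogicExpr k), (match k, e with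
      | .state, f => Continuous (D.interp obs c f) ∧
          ∀ x, 0 ≤ D.interp obs c f x ∧ D.interp obs c f x ≤ 1
      | .traj, g => Continuous (D.interp obs c g) ∧
          ∀ ω, 0 ≤ D.interp obs c g ω ∧ D.interp obs c g ω ≤ 1) := by
  intro k e
  induction e with
  | const q =>
    have h := q.2
    refine ⟨continuous_const, fun x => ⟨?_, ?_⟩⟩
    · simpa [interp] using h.1
    · simpa [interp] using (by exact_mod_cast h.2 : (((q : ℚ) : ℝ)) ≤ 1)
  | obs => exact ⟨hobs, hobs01⟩
  | compl f ih =>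
    exact ⟨continuous_const.sub ih.1, fun x => ⟨by simpa [interp] using (ih.2 x).2,
      by simpa [interp] using (ih.2 x).1⟩⟩
  | integral g ih =>
    obtain ⟨hc, hb⟩ := ih
    have hbdd : ∀ ω : Traj E, ‖D.interp obs c g ω‖ ≤ 1 := fun ω => by
      rw [Real.norm_eq_abs, abs_le]
      exact ⟨by linarith [(hb ω).1], (hb ω).2⟩
    let G : BoundedContinuousFunction (Traj E) ℝ :=
      BoundedContinuousFunction.ofNormedAddCommGroup (D.interp obs c g) hc 1 hbdd
    refine ⟨?_, fun x => ⟨integral_nonneg fun ω => (hb ω).1, ?_⟩⟩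
    · refine continuous_iff_continuousAt.2 fun x => ?_
      exact (ProbabilityMeasure.tendsto_iff_forall_integral_tendsto.1
        (D.continuous_law.tendsto x)) G
    · have h := norm_integral_le_of_norm_le_const (μ := (D.law x : Measure (Traj E)))
        (Eventually.of_forall hbdd)
      simpa [interp] using (le_abs_self _).trans h
  | ev f t ih =>
    have h1 : c ^ (t : ℝ) ≤ 1 := Real.rpow_le_one hc0.le hc1.le (by positivity)
    have h0 : 0 ≤ c ^ (t : ℝ) := Real.rpow_nonneg hc0.le _
    exact ⟨continuous_const.mul (ih.1.comp (continuous_eval_const (t : ℝ≥0))),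
      fun ω => ⟨mul_nonneg h0 (ih.2 _).1, mul_le_one₀ h1 (ih.2 _).1 (ih.2 _).2⟩⟩
  | min g₁ g₂ ih₁ ih₂ =>
    exact ⟨ih₁.1.min ih₂.1, fun ω => ⟨le_min (ih₁.2 ω).1 (ih₂.2 ω).1,
      (min_le_left _ _).trans (ih₁.2 ω).2⟩⟩
  | max g₁ g₂ ih₁ ih₂ =>
    exact ⟨ih₁.1.max ih₂.1, fun ω => ⟨(ih₁.2 ω).1.trans (le_max_left _ _),
      max_le (ih₁.2 ω).2 (ih₂.2 ω).2⟩⟩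
  | minus g q ih =>
    have hq : (0 : ℝ) ≤ ((q : ℚ) : ℝ) := by exact_mod_cast q.2.1
    exact ⟨continuous_const.max (ih.1.sub continuous_const), fun ω => ⟨le_max_left _ _,
      max_le zero_le_one (by linarith [(ih.2 ω).2])⟩⟩
  | plus g q ih =>
    have hq : (0 : ℝ) ≤ ((q : ℚ) : ℝ) := by exact_mod_cast q.2.1
    exact ⟨continuous_const.min (ih.1.add continuous_const), fun ω => ⟨le_min zero_le_one
      (by linarith [(ih.2 ω).1]), min_le_left _ _⟩⟩

/-- The pseudometric `ℓ^c(x, y) = sup_f |f(x) - f(y)|`, over the expressions `f` on states. -/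
noncomputable def logicDist (D : Diffusion E) (obs : E → ℝ) (c : ℝ) (x y : E) : ℝ :=
  ⨆ f : LogicExpr .state, |D.interp obs c f x - D.interp obs c f y|

end Diffusion

end TrajMetric

/-!
Every expression on states is nonexpansive for `dₙ` as soon as `n` is large, because `min`, `max`,
truncation and discounted evaluation preserve nonexpansiveness and `∫` turns a
`U_c(dₙ)`-nonexpansive function into a `dₙ₊₁`-nonexpansive one. Hence `ℓ ≤ sup dₙ`.

Conversely, expressions attain every `dₙ`, by induction on `n`. By transport duality, which finite
linear programming gives after quantization on a finite net, `dₙ₊₁(x, y)` is the supremum of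
`∫ h dPˣ - ∫ h dPʸ` over the `U_c(dₙ)`-nonexpansive functions `h` on trajectories. The nonexpansive
trajectory expressions form a lattice which, by the induction hypothesis, contains for any two
trajectories an expression close to `h` at both. As in the Stone-Weierstrass theorem the lattice
then approximates `h` on finite nets, and by nonexpansiveness in mean for `Pˣ` and `Pʸ`.
-/

namespace TrajMetric

/-! ### Nonexpansive functions -/

/-- The `[0, 1]`-valued functions that are nonexpansive for the cost `k`; for a symmetric `k` the
one-sided inequality says `|h x - h y| ≤ k x y`. -/
structure Nonexpansive {X : Type*} (k : X → X → ℝ) (h : X → ℝ) : Prop where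
  sub_le : ∀ x y, h x - h y ≤ k x y
  nonneg : ∀ x, 0 ≤ h x
  le_one : ∀ x, h x ≤ 1

namespace Nonexpansive

variable {X ι : Type*} {k : X → X → ℝ} {g h : X → ℝ}

theorem const (hk : ∀ x y, 0 ≤ k x y) {q : ℝ} (hq₀ : 0 ≤ q) (hq₁ : q ≤ 1) :
    Nonexpansive k fun _ => q :=
  ⟨fun x y => by simpa using hk x y, fun _ => hq₀, fun _ => hq₁⟩

theorem one_sub (hk : ∀ x y, k x y = k y x) (hh : Nonexpansive k h) :
    Nonexpansive k fun x => 1 - h x :=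
  ⟨fun x y => by linarith [hh.sub_le y x, hk x y], fun x => by linarith [hh.le_one x],
    fun x => by linarith [hh.nonneg x]⟩

theorem sup (hg : Nonexpansive k g) (hh : Nonexpansive k h) : Nonexpansive k (g ⊔ h) where
  sub_le x y := sub_le_iff_le_add.2 <| sup_le
    (by linarith [hg.sub_le x y, le_max_left (g y) (h y), Pi.sup_apply g h y])
    (by linarith [hh.sub_le x y, le_max_right (g y) (h y), Pi.sup_apply g h y])
  nonneg x := (hg.nonneg x).trans (le_max_left _ _)
  le_one x := max_le (hg.le_one x) (hh.le_one x)

theorem inf (hg : Nonexpansive k g) (hh : Nonexpansive k h) : Nonexpansive k (g ⊓ h) where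
  sub_le x y := sub_le_comm.1 <| le_inf
    (by linarith [hg.sub_le x y, min_le_left (g x) (h x), Pi.inf_apply g h x])
    (by linarith [hh.sub_le x y, min_le_right (g x) (h x), Pi.inf_apply g h x])
  nonneg x := le_min (hg.nonneg x) (hh.nonneg x)
  le_one x := (min_le_left _ _).trans (hg.le_one x)

theorem iInf [Nonempty ι] {F : ι → X → ℝ} (hF : ∀ i, Nonexpansive k (F i)) :
    Nonexpansive k fun x => ⨅ i, F i x where
  sub_le x y := sub_le_comm.1 <| le_ciInf fun i => by
    linarith [(hF i).sub_le x y,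
      ciInf_le ⟨0, Set.forall_mem_range.2 fun j => (hF j).nonneg x⟩ i]
  nonneg x := le_ciInf fun i => (hF i).nonneg x
  le_one x := ciInf_le_of_le ⟨0, Set.forall_mem_range.2 fun j => (hF j).nonneg x⟩
    (Classical.arbitrary ι) ((hF _).le_one x)

theorem truncSub (hh : Nonexpansive k h) (hk : ∀ x y, 0 ≤ k x y) {q : ℝ} (hq : 0 ≤ q) :
    Nonexpansive k fun x => max 0 (h x - q) where
  sub_le x y := sub_le_iff_le_add.2 <| max_le
    (add_nonneg (hk x y) (le_max_left _ _))
    (by linarith [hh.sub_le x y, le_max_right 0 (h y - q)])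
  nonneg _ := le_max_left _ _
  le_one x := max_le zero_le_one (by linarith [hh.le_one x])

theorem truncAdd (hh : Nonexpansive k h) (hk : ∀ x y, 0 ≤ k x y) {q : ℝ} (hq : 0 ≤ q) :
    Nonexpansive k fun x => min 1 (h x + q) where
  sub_le x y := sub_le_comm.1 <| le_min
    (by linarith [hk x y, min_le_left 1 (h x + q)])
    (by linarith [hh.sub_le x y, min_le_right 1 (h x + q)])
  nonneg x := le_min zero_le_one (add_nonneg (hh.nonneg x) hq)
  le_one _ := min_le_left _ _

end Nonexpansive

/-! ### Continuous pseudometrics -/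

/-- `1`-bounded pseudometrics that are jointly continuous for the given topology, which may be
finer than the one that they induce. -/
structure IsContinuousPseudometric {X : Type*} [TopologicalSpace X] (k : X → X → ℝ) : Prop
    extends IsPseudometric k where
  continuous : Continuous fun p : X × X => k p.1 p.2

namespace IsPseudometric

variable {X Y : Type*} {k : X → X → ℝ} {h : X → ℝ}

theorem abs_sub_le (hk : IsPseudometric k) (hh : Nonexpansive k h) (x y : X) :
    |h x - h y| ≤ k x y :=
  abs_sub_le_iff.2 ⟨hh.sub_le x y, hk.symm y x ▸ hh.sub_le y x⟩

theorem nonexpansive (hk : IsPseudometric k) (a : X) : Nonexpansive k fun x => k x a :=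
  ⟨fun x y => sub_le_iff_le_add.2 (hk.triangle x y a), fun x => hk.nonneg x a,
    fun x => hk.le_one x a⟩

theorem comap (hk : IsPseudometric k) (f : Y → X) : IsPseudometric fun x y => k (f x) (f y) :=
  ⟨fun _ _ => hk.nonneg _ _, fun _ _ => hk.le_one _ _, fun _ => hk.self _,
    fun _ _ => hk.symm _ _, fun _ _ _ => hk.triangle _ _ _⟩

theorem isContinuousPseudometric [TopologicalSpace X] (hk : IsPseudometric k)
    (h₀ : ∀ x, Tendsto (k x) (𝓝 x) (𝓝 0)) : IsContinuousPseudometric k := by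
  refine ⟨hk, continuous_iff_continuousAt.2 fun ⟨x, y⟩ => tendsto_iff_dist_tendsto_zero.2 ?_⟩
  have hsum : Tendsto (fun p : X × X => k x p.1 + k y p.2) (𝓝 (x, y)) (𝓝 0) := by
    simpa using ((h₀ x).comp (continuous_fst.tendsto (x, y))).add
      ((h₀ y).comp (continuous_snd.tendsto (x, y)))
  refine squeeze_zero (fun _ => dist_nonneg) (fun p => ?_) hsum
  rw [Real.dist_eq, abs_sub_le_iff]
  constructor
  · linarith [hk.triangle p.1 x p.2, hk.triangle x y p.2, hk.symm p.1 x]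
  · linarith [hk.triangle x p.1 y, hk.triangle p.1 p.2 y, hk.symm p.2 y]

end IsPseudometric

theorem IsContinuousPseudometric.tendsto_nhds_zero {X : Type*} [TopologicalSpace X]
    {k : X → X → ℝ} (hk : IsContinuousPseudometric k) (x : X) : Tendsto (k x) (𝓝 x) (𝓝 0) := by
  have h : Continuous (k x) := hk.continuous.comp (Continuous.prodMk_right x)
  simpa only [hk.self x] using h.tendsto x

namespace Nonexpansive

variable {X : Type*} [TopologicalSpace X] {k : X → X → ℝ} {h : X → ℝ}

theorem continuous (hh : Nonexpansive k h) (hk : IsContinuousPseudometric k) : Continuous h := by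
  refine continuous_iff_continuousAt.2 fun x => tendsto_iff_dist_tendsto_zero.2 ?_
  refine squeeze_zero (fun _ => dist_nonneg) (fun y => ?_) (hk.tendsto_nhds_zero x)
  rw [Real.dist_eq, hk.symm]
  exact hk.abs_sub_le hh y x

variable [MeasurableSpace X] [BorelSpace X]

theorem integrable (hh : Nonexpansive k h) (hk : IsContinuousPseudometric k) (μ : Measure X)
    [IsFiniteMeasure μ] : Integrable h μ :=
  .of_mem_Icc 0 1 (hh.continuous hk).measurable.aemeasurable
    (.of_forall fun x => ⟨hh.nonneg x, hh.le_one x⟩)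

theorem continuous_integral (hh : Nonexpansive k h) (hk : IsContinuousPseudometric k) :
    Continuous fun μ : ProbabilityMeasure X => ∫ x, h x ∂(μ : Measure X) :=
  ProbabilityMeasure.continuous_integral_boundedContinuousFunction
    (.ofNormedAddCommGroup h (hh.continuous hk) 1 fun x => by
      rw [Real.norm_of_nonneg (hh.nonneg x)]; exact hh.le_one x)

end Nonexpansive

/-! ### Finite nets -/

section Net

variable {X ι : Type*} {k : X → X → ℝ}

/-- The distance `⨅ i, k x (a i)` of `x` from the net `a`. -/
noncomputable def netDist (k : X → X → ℝ) (a : ι → X) (x : X) : ℝ :=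
  ⨅ i, k x (a i)

theorem IsPseudometric.nonexpansive_netDist [Nonempty ι] (hk : IsPseudometric k) (a : ι → X) :
    Nonexpansive k (netDist k a) :=
  .iInf fun i => hk.nonexpansive (a i)

theorem IsPseudometric.netDist_le (hk : IsPseudometric k) (a : ι → X) (x : X) (i : ι) :
    netDist k a x ≤ k x (a i) :=
  ciInf_le ⟨0, Set.forall_mem_range.2 fun j => hk.nonneg x (a j)⟩ i

theorem IsPseudometric.abs_sub_le_two_mul_netDist_add [Nonempty ι] (hk : IsPseudometric k)
    {g h : X → ℝ} (hg : Nonexpansive k g) (hh : Nonexpansive k h) {a : ι → X} {ε : ℝ}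
    (hgh : ∀ i, |g (a i) - h (a i)| ≤ ε) (x : X) : |g x - h x| ≤ 2 * netDist k a x + ε := by
  have hbound : ∀ i, (|g x - h x| - ε) / 2 ≤ k x (a i) := fun i => by
    have hgi := abs_le.1 (hk.abs_sub_le hg x (a i))
    have hhi := abs_le.1 (hk.abs_sub_le hh x (a i))
    have hi := abs_le.1 (hgh i)
    have : |g x - h x| ≤ 2 * k x (a i) + ε := abs_le.2 ⟨by linarith, by linarith⟩
    linarith
  have hnet : (|g x - h x| - ε) / 2 ≤ netDist k a x := le_ciInf hbound
  linarith

theorem exists_measurable_eq_iInf [MeasurableSpace X] [Finite ι] [Nonempty ι] [LinearOrder ι]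
    [MeasurableSpace ι] {F : ι → X → ℝ} (hF : ∀ i, Measurable (F i)) :
    ∃ T : X → ι, Measurable T ∧ ∀ x, F (T x) x = ⨅ i, F i x := by
  classical
  have := Fintype.ofFinite ι
  let argmin (x : X) : Finset ι := {i | F i x = ⨅ j, F j x}
  have hmem (i : ι) (x : X) : i ∈ argmin x ↔ F i x = ⨅ j, F j x := by simp [argmin]
  have hne (x : X) : (argmin x).Nonempty :=
    (exists_eq_ciInf_of_finite (f := fun i => F i x)).imp fun i hi => (hmem i x).2 hi
  have hmeas (i : ι) : MeasurableSet {x | i ∈ argmin x} := by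
    simp only [hmem]
    exact measurableSet_eq_fun (hF i) (Measurable.iInf hF)
  refine ⟨fun x => (argmin x).min' (hne x), measurable_to_countable' fun i => ?_,
    fun x => (hmem _ x).1 (Finset.min'_mem _ _)⟩
  have hfiber : (fun x => (argmin x).min' (hne x)) ⁻¹' {i} =
      {x | i ∈ argmin x} ∩ ⋂ j < i, {x | j ∈ argmin x}ᶜ := by
    ext x
    simp only [Set.mem_preimage, Set.mem_singleton_iff, Finset.min'_eq_iff, Set.mem_inter_iff,
      Set.mem_ofPred_eq, Set.mem_iInter, Set.mem_compl_iff]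
    exact and_congr_right fun _ => ⟨fun h j hji hj => (h j hj).not_gt hji,
      fun h j hj => not_lt.1 fun hji => h j hji hj⟩
  rw [hfiber]
  exact (hmeas i).inter (.iInter fun j => .iInter fun _ => (hmeas j).compl)

variable [TopologicalSpace X] [MeasurableSpace X] [BorelSpace X]

theorem IsContinuousPseudometric.integral_abs_sub_le [Nonempty ι]
    (hk : IsContinuousPseudometric k) (μ : Measure X) [IsProbabilityMeasure μ] {g h : X → ℝ}
    (hg : Nonexpansive k g) (hh : Nonexpansive k h) {a : ι → X} {ε : ℝ}
    (hgh : ∀ i, |g (a i) - h (a i)| ≤ ε) :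
    ∫ x, |g x - h x| ∂μ ≤ 2 * ∫ x, netDist k a x ∂μ + ε := by
  have hnet := ((hk.nonexpansive_netDist a).integrable hk μ).const_mul 2
  calc ∫ x, |g x - h x| ∂μ
      ≤ ∫ x, (2 * netDist k a x + ε) ∂μ :=
        integral_mono ((hg.integrable hk μ).sub (hh.integrable hk μ)).abs
          (hnet.add (integrable_const ε)) (hk.abs_sub_le_two_mul_netDist_add hg hh hgh)
    _ = 2 * ∫ x, netDist k a x ∂μ + ε := by
        rw [integral_add hnet (integrable_const ε), integral_const_mul, integral_const]
        simp

theorem IsContinuousPseudometric.exists_integral_netDist_lt [TopologicalSpace.SeparableSpace X]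
    [Nonempty X] (hk : IsContinuousPseudometric k) (μ : Measure X) [IsFiniteMeasure μ] {ε : ℝ}
    (hε : 0 < ε) : ∃ n, ∃ a : Fin (n + 1) → X, ∫ x, netDist k a x ∂μ < ε := by
  let net (n : ℕ) (i : Fin (n + 1)) : X := TopologicalSpace.denseSeq X i
  have hnet (n : ℕ) := hk.nonexpansive_netDist (net n)
  have hlim (x : X) : Tendsto (fun n => netDist k (net n) x) atTop (𝓝 0) := by
    refine tendsto_order.2 ⟨fun r hr => .of_forall fun n => hr.trans_le ((hnet n).nonneg x),
      fun r hr => ?_⟩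
    obtain ⟨V, hVr, hV, hxV⟩ :=
      mem_nhds_iff.1 ((hk.tendsto_nhds_zero x).eventually_lt_const hr)
    obtain ⟨N, hN⟩ := (TopologicalSpace.denseRange_denseSeq X).exists_mem_open hV ⟨x, hxV⟩
    filter_upwards [eventually_ge_atTop N] with n hn
    exact (hk.netDist_le (net n) x ⟨N, Nat.lt_succ_of_le hn⟩).trans_lt (hVr hN)
  have hint : Tendsto (fun n => ∫ x, netDist k (net n) x ∂μ) atTop (𝓝 0) := by
    simpa using tendsto_integral_of_dominated_convergence (μ := μ) (fun _ => (1 : ℝ))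
      (fun n => ((hnet n).continuous hk).aestronglyMeasurable) (integrable_const 1)
      (fun n => .of_forall fun x => by
        rw [Real.norm_of_nonneg ((hnet n).nonneg x)]; exact (hnet n).le_one x)
      (.of_forall hlim)
  obtain ⟨n, hn⟩ := (hint.eventually_lt_const hε).exists
  exact ⟨n, net n, hn⟩

end Net

/-! ### McShane extension -/

section McShane

variable {X ι : Type*} {k : X → X → ℝ}

/-- The largest nonexpansive function with value at most `v i` at `a i` for every `i`; it extends
`v` when `v` is nonexpansive along `a`. -/
noncomputable def mcShane (k : X → X → ℝ) (a : ι → X) (v : ι → unitInterval) (x : X) : ℝ :=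
  ⨅ i, min 1 (k x (a i) + v i)

theorem IsPseudometric.nonexpansive_mcShane [Nonempty ι] (hk : IsPseudometric k) (a : ι → X)
    (v : ι → unitInterval) : Nonexpansive k (mcShane k a v) :=
  .iInf fun i => (hk.nonexpansive (a i)).truncAdd hk.nonneg (v i).2.1

theorem IsPseudometric.mcShane_apply (hk : IsPseudometric k) (a : ι → X) {v : ι → unitInterval}
    (hv : Nonexpansive (fun i j => k (a i) (a j)) fun i => (v i : ℝ)) (i : ι) :
    mcShane k a v (a i) = v i := by
  have : Nonempty ι := ⟨i⟩
  refine le_antisymm ?_ (le_ciInf fun j => le_min (hv.le_one i) ?_)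
  · refine ciInf_le_of_le ⟨0, Set.forall_mem_range.2 fun j => ?_⟩ i ?_
    · exact le_min zero_le_one (add_nonneg (hk.nonneg _ _) (v j).2.1)
    · simp [hk.self, (v i).2.2]
  · linarith [hv.sub_le i j]

theorem IsPseudometric.mcShane_sub_le [Fintype ι] [Nonempty ι] (hk : IsPseudometric k)
    (a : ι → X) (v w : ι → unitInterval) (x : X) :
    mcShane k a v x - mcShane k a w x ≤ dist v w := by
  refine sub_le_comm.1 (le_ciInf fun i => ?_)
  have hle : mcShane k a v x ≤ min 1 (k x (a i) + v i) :=
    ciInf_le ⟨0, Set.forall_mem_range.2 fun j =>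
      le_min zero_le_one (add_nonneg (hk.nonneg _ _) (v j).2.1)⟩ i
  have hdist : (v i : ℝ) - w i ≤ dist v w := (le_abs_self _).trans (dist_le_pi_dist v w i)
  refine le_min ?_ ?_
  · linarith [min_le_left 1 (k x (a i) + v i), dist_nonneg (x := v) (y := w)]
  · linarith [min_le_right 1 (k x (a i) + v i)]

theorem IsContinuousPseudometric.continuous_integral_mcShane [Finite ι] [Nonempty ι]
    [TopologicalSpace X] [MeasurableSpace X] [BorelSpace X] (hk : IsContinuousPseudometric k)
    (a : ι → X) :
    Continuous fun p : ProbabilityMeasure X × (ι → unitInterval) =>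
      ∫ x, mcShane k a p.2 x ∂(p.1 : Measure X) := by
  have := Fintype.ofFinite ι
  have hmc (v : ι → unitInterval) := hk.nonexpansive_mcShane a v
  refine continuous_iff_continuousAt.2 fun ⟨μ, v⟩ => tendsto_iff_dist_tendsto_zero.2 ?_
  have hsum : Tendsto (fun p : ProbabilityMeasure X × (ι → unitInterval) => dist p.2 v +
      dist (∫ x, mcShane k a v x ∂(p.1 : Measure X)) (∫ x, mcShane k a v x ∂(μ : Measure X)))
      (𝓝 (μ, v)) (𝓝 0) := by
    have hcont := (continuous_snd.dist (continuous_const (y := v))).add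
      ((((hmc v).continuous_integral hk).comp continuous_fst).dist
        (continuous_const (y := ∫ x, mcShane k a v x ∂(μ : Measure X))))
    simpa [Pi.add_def] using hcont.tendsto (μ, v)
  refine squeeze_zero (fun _ => dist_nonneg)
    (fun p => (dist_triangle _ (∫ x, mcShane k a v x ∂(p.1 : Measure X)) _).trans ?_) hsum
  gcongr
  rw [dist_eq_norm, ← integral_sub ((hmc p.2).integrable hk _) ((hmc v).integrable hk _)]
  have hdist (x : X) : ‖mcShane k a p.2 x - mcShane k a v x‖ ≤ dist p.2 v :=
    abs_sub_le_iff.2 ⟨hk.mcShane_sub_le a p.2 v x, dist_comm p.2 v ▸ hk.mcShane_sub_le a v p.2 x⟩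
  simpa using norm_integral_le_of_norm_le_const (μ := (p.1 : Measure X)) (.of_forall hdist)

end McShane

/-! ### Finite transport duality -/

section FiniteDuality

variable {I J : Type*} [Fintype I] [Fintype J]

theorem exists_eq_sum_mul_of_linearMap (f : (I → ℝ) × (J → ℝ) × ℝ →ₗ[ℝ] ℝ) :
    ∃ (A : I → ℝ) (B : J → ℝ) (l : ℝ), ∀ x y r,
      f (x, y, r) = ∑ i, x i * A i + ∑ j, y j * B j + r * l := by
  classical
  refine ⟨fun i => f (fun i' => if i = i' then 1 else 0, 0, 0),
    fun j => f (0, fun j' => if j = j' then 1 else 0, 0), f (0, 0, 1), fun x y r => ?_⟩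
  have hx : f (x, 0, 0) = ∑ i, x i * f (fun i' => if i = i' then 1 else 0, 0, 0) :=
    (f ∘ₗ .inl ℝ _ _).pi_apply_eq_sum_univ x
  have hy : f (0, y, 0) = ∑ j, y j * f (0, fun j' => if j = j' then 1 else 0, 0) :=
    (f ∘ₗ .inr ℝ _ _ ∘ₗ .inl ℝ _ _).pi_apply_eq_sum_univ y
  have hr : f (0, 0, r) = r * f (0, 0, 1) := by
    rw [← smul_eq_mul, ← map_smul]
    simp
  rw [← hx, ← hy, ← hr, ← map_add, ← map_add]
  simp

theorem exists_separation_of_forall_plan_lt (k : I → J → ℝ) {p : I → ℝ} {q : J → ℝ} {S : ℝ}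
    (hS : ∀ w ∈ stdSimplex ℝ (I × J), (∀ i, ∑ j, w (i, j) = p i) → (∀ j, ∑ i, w (i, j) = q j) →
      S < ∑ z, w z * k z.1 z.2) :
    ∃ (A : I → ℝ) (B : J → ℝ) (l u : ℝ),
      (∀ w ∈ stdSimplex ℝ (I × J),
        ∑ i, (∑ j, w (i, j)) * A i + ∑ j, (∑ i, w (i, j)) * B j +
          (∑ z, w z * k z.1 z.2) * l < u) ∧
      u < ∑ i, p i * A i + ∑ j, q j * B j + S * l := by
  let L : (I × J → ℝ) →ₗ[ℝ] (I → ℝ) × (J → ℝ) × ℝ :=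
    (LinearMap.pi fun i => ∑ j, LinearMap.proj (i, j)).prod
      ((LinearMap.pi fun j => ∑ i, LinearMap.proj (i, j)).prod
        (∑ z : I × J, k z.1 z.2 • LinearMap.proj z))
  have hL (w : I × J → ℝ) :
      L w = (fun i => ∑ j, w (i, j), fun j => ∑ i, w (i, j), ∑ z, w z * k z.1 z.2) := by
    refine Prod.ext (funext fun i => ?_) (Prod.ext (funext fun j => ?_) ?_) <;>
      simp [L, LinearMap.sum_apply, mul_comm]
  have hdisj : Disjoint (L '' stdSimplex ℝ (I × J)) ({p} ×ˢ {q} ×ˢ Set.Iic S) := by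
    rw [Set.disjoint_left]
    rintro _ ⟨w, hw, rfl⟩ ⟨hp, hq, hcost⟩
    rw [hL] at hp hq hcost
    exact (hS w hw (congrFun hp) (congrFun hq)).not_ge hcost
  obtain ⟨f, u, v, hu, huv, hv⟩ := geometric_hahn_banach_compact_closed
    ((convex_stdSimplex ℝ (I × J)).linear_image L)
    ((isCompact_stdSimplex ℝ (I × J)).image L.continuous_of_finiteDimensional)
    ((convex_singleton p).prod ((convex_singleton q).prod (convex_Iic S)))
    (isClosed_singleton.prod (isClosed_singleton.prod isClosed_Iic)) hdisj
  obtain ⟨A, B, l, hf⟩ := exists_eq_sum_mul_of_linearMap f.toLinearMap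
  refine ⟨A, B, l, u, fun w hw => ?_, ?_⟩
  · rw [← hf, ← hL]
    exact hu _ ⟨w, hw, rfl⟩
  · rw [← hf]
    exact huv.trans (hv _ ⟨rfl, rfl, le_refl S⟩)

theorem exists_plan_of_dual_le (k : I → J → ℝ) {p : I → ℝ} {q : J → ℝ} {S : ℝ}
    (hp : p ∈ stdSimplex ℝ I) (hq : q ∈ stdSimplex ℝ J)
    (hS : ∀ (A : I → ℝ) (B : J → ℝ), (∀ i j, A i + B j ≤ k i j) →
      ∑ i, p i * A i + ∑ j, q j * B j ≤ S) :
    ∃ w ∈ stdSimplex ℝ (I × J), (∀ i, ∑ j, w (i, j) = p i) ∧ (∀ j, ∑ i, w (i, j) = q j) ∧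
      ∑ z, w z * k z.1 z.2 ≤ S := by
  classical
  by_contra! hplan
  obtain ⟨A, B, l, u, hlt, hgt⟩ := exists_separation_of_forall_plan_lt k hplan
  have hl : l < 0 := by
    let w (z : I × J) : ℝ := p z.1 * q z.2
    have hfst (i : I) : ∑ j, w (i, j) = p i := by simp [w, ← Finset.mul_sum, hq.2]
    have hsnd (j : J) : ∑ i, w (i, j) = q j := by simp [w, ← Finset.sum_mul, hp.2]
    have hw : w ∈ stdSimplex ℝ (I × J) :=
      ⟨fun z => mul_nonneg (hp.1 _) (hq.1 _), by simp [Fintype.sum_prod_type, hfst, hp.2]⟩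
    have hw_lt := hlt w hw
    simp only [hfst, hsnd] at hw_lt
    nlinarith [hplan w hw hfst hsnd]
  have hpair (i : I) (j : J) : A i + B j + k i j * l < u := by
    simpa [Pi.single_apply, Fintype.sum_prod_type, ite_and] using
      hlt _ (single_mem_stdSimplex ℝ (i, j))
  have hdual := hS (fun i => (u - A i) / l) (fun j => -B j / l) fun i j => by
    rw [← add_div, div_le_iff_of_neg hl]
    linarith [hpair i j]
  have hvalue : ∑ i, p i * ((u - A i) / l) + ∑ j, q j * (-B j / l) =
      (u - (∑ i, p i * A i + ∑ j, q j * B j)) / l := by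
    simp only [← mul_div_assoc, ← Finset.sum_div, mul_sub, Finset.sum_sub_distrib,
      ← Finset.sum_mul, hp.2, mul_neg, Finset.sum_neg_distrib]
    ring
  rw [hvalue, div_le_iff_of_neg hl] at hdual
  linarith

theorem exists_mem_couplings_of_plan [MeasurableSpace I] [MeasurableSingletonClass I]
    {μ ν : ProbabilityMeasure I} {w : I × I → ℝ} (hw : w ∈ stdSimplex ℝ (I × I))
    (hμ : ∀ i, ∑ j, w (i, j) = (μ : Measure I).real {i})
    (hν : ∀ j, ∑ i, w (i, j) = (ν : Measure I).real {j}) :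
    ∃ γ ∈ couplings μ ν, ∀ z, (γ : Measure (I × I)).real {z} = w z := by
  classical
  let π : PMF (I × I) := .ofFintype (fun z => .ofReal (w z)) <| by
    rw [← ENNReal.ofReal_sum_of_nonneg fun z _ => hw.1 z, hw.2, ENNReal.ofReal_one]
  refine ⟨⟨π.toMeasure, inferInstance⟩,
    ⟨Measure.ext_of_singleton fun i => ?_, Measure.ext_of_singleton fun j => ?_⟩, fun z => ?_⟩
  · rw [← ofReal_measureReal (μ := (μ : Measure I)), ← hμ,
      ENNReal.ofReal_sum_of_nonneg fun j _ => hw.1 _]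
    simp [Measure.map_apply measurable_fst, PMF.toMeasure_apply_fintype, Set.indicator_apply,
      Fintype.sum_prod_type_right, π]
  · rw [← ofReal_measureReal (μ := (ν : Measure I)), ← hν,
      ENNReal.ofReal_sum_of_nonneg fun i _ => hw.1 _]
    simp [Measure.map_apply measurable_snd, PMF.toMeasure_apply_fintype, Set.indicator_apply,
      Fintype.sum_prod_type, π]
  · simp [measureReal_def, π, hw.1 z]

end FiniteDuality

theorem Nonexpansive.sub_iInf {X : Type*} [Nonempty X] {k : X → X → ℝ} {f : X → ℝ}
    (hk : ∀ x y, k x y ≤ 1) (hf : ∀ x y, f x - f y ≤ k x y) :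
    Nonexpansive k fun x => f x - ⨅ y, f y := by
  have hbdd : BddBelow (Set.range f) :=
    ⟨f (Classical.arbitrary X) - 1, Set.forall_mem_range.2 fun y => by
      linarith [hf (Classical.arbitrary X) y, hk (Classical.arbitrary X) y]⟩
  refine ⟨fun x y => by linarith [hf x y], fun x => sub_nonneg.2 (ciInf_le hbdd x), fun x => ?_⟩
  exact sub_le_comm.1 (le_ciInf fun y => by linarith [hf x y, hk x y])

theorem IsPseudometric.exists_between_of_add_le {X : Type*} [Nonempty X] {k : X → X → ℝ}
    (hk : IsPseudometric k) {A B : X → ℝ} (hAB : ∀ x y, A x + B y ≤ k x y) :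
    ∃ f : X → ℝ, (∀ x y, f x - f y ≤ k x y) ∧ (∀ x, A x ≤ f x) ∧ ∀ x, f x ≤ -B x := by
  have hA (x z : X) : A x ≤ k x z - B z := le_sub_iff_add_le.2 (hAB x z)
  have hbdd (x : X) : BddBelow (Set.range fun z => k x z - B z) :=
    ⟨A x, Set.forall_mem_range.2 (hA x)⟩
  refine ⟨fun x => ⨅ z, (k x z - B z), fun x y => ?_, fun x => le_ciInf (hA x), fun x => ?_⟩
  · refine sub_le_comm.1 (le_ciInf fun z => ?_)
    linarith [ciInf_le (hbdd x) z, hk.triangle x y z]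
  · exact (ciInf_le (hbdd x) x).trans_eq (by rw [hk.self, zero_sub])

theorem IsPseudometric.exists_coupling_integral_le_of_finite {X : Type*} [Finite X]
    [MeasurableSpace X] [MeasurableSingletonClass X] {k : X → X → ℝ} (hk : IsPseudometric k)
    (μ ν : ProbabilityMeasure X) {S : ℝ}
    (hS : ∀ f, Nonexpansive k f → ∫ x, f x ∂(μ : Measure X) - ∫ x, f x ∂(ν : Measure X) ≤ S) :
    ∃ γ ∈ couplings μ ν, ∫ z, k z.1 z.2 ∂(γ : Measure (X × X)) ≤ S := by
  have := Fintype.ofFinite X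
  have : Nonempty X := nonempty_of_isProbabilityMeasure (μ : Measure X)
  have hsimplex (ρ : ProbabilityMeasure X) :
      (fun x => (ρ : Measure X).real {x}) ∈ stdSimplex ℝ X :=
    ⟨fun _ => measureReal_nonneg, by
      simpa using sum_measureReal_singleton (μ := (ρ : Measure X)) Finset.univ⟩
  have hsum (ρ : ProbabilityMeasure X) (f : X → ℝ) :
      ∑ x, (ρ : Measure X).real {x} * f x = ∫ x, f x ∂(ρ : Measure X) := by
    simp [integral_fintype]
  obtain ⟨w, hw, hwμ, hwν, hcost⟩ := exists_plan_of_dual_le k (hsimplex μ) (hsimplex ν) (S := S)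
    fun A B hAB => by
      obtain ⟨f, hf, hAf, hfB⟩ := hk.exists_between_of_add_le hAB
      have hμA : ∫ x, A x ∂(μ : Measure X) ≤ ∫ x, f x ∂(μ : Measure X) :=
        integral_mono .of_finite .of_finite hAf
      have hνB : ∫ x, B x ∂(ν : Measure X) ≤ -∫ x, f x ∂(ν : Measure X) := by
        rw [← integral_neg]
        exact integral_mono .of_finite .of_finite fun x => le_neg.2 (hfB x)
      have hdual := hS _ (.sub_iInf hk.le_one hf)
      simp only [integral_sub Integrable.of_finite (integrable_const _), integral_const,
        probReal_univ, one_smul] at hdual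
      rw [hsum, hsum]
      linarith
  obtain ⟨γ, hγ, hγw⟩ := exists_mem_couplings_of_plan hw hwμ hwν
  refine ⟨γ, hγ, ?_⟩
  rw [integral_fintype .of_finite]
  simpa only [hγw, smul_eq_mul] using hcost

/-! ### Lifting couplings -/

section Lift

variable {X Y I J : Type*} [MeasurableSpace X] [MeasurableSpace Y] [MeasurableSpace I]
  [MeasurableSpace J]

theorem map_withDensity_comp (μ : Measure X) {T : X → I} (hT : Measurable T) {ρ : I → ℝ≥0∞}
    (hρ : Measurable ρ) : (μ.withDensity (ρ ∘ T)).map T = (μ.map T).withDensity ρ := by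
  ext s hs
  rw [Measure.map_apply hT hs, withDensity_apply _ (hT hs), withDensity_apply _ hs,
    setLIntegral_map hs hρ hT]
  rfl

theorem map_fst_withDensity_prod (μ : Measure X) (ν : Measure Y) [SFinite μ] [SFinite ν]
    {ρ : X × Y → ℝ≥0∞} (hρ : Measurable ρ) :
    ((μ.prod ν).withDensity ρ).map Prod.fst = μ.withDensity fun x => ∫⁻ y, ρ (x, y) ∂ν := by
  ext s hs
  rw [Measure.map_apply measurable_fst hs, withDensity_apply _ (measurable_fst hs),
    withDensity_apply _ hs, ← Set.prod_univ, setLIntegral_prod _ hρ.aemeasurable]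
  simp only [Measure.restrict_univ]

theorem map_snd_withDensity_prod (μ : Measure X) (ν : Measure Y) [SFinite μ] [SFinite ν]
    {ρ : X × Y → ℝ≥0∞} (hρ : Measurable ρ) :
    ((μ.prod ν).withDensity ρ).map Prod.snd = ν.withDensity fun y => ∫⁻ x, ρ (x, y) ∂μ := by
  ext s hs
  rw [Measure.map_apply measurable_snd hs, withDensity_apply _ (measurable_snd hs),
    withDensity_apply _ hs, ← Set.univ_prod, setLIntegral_prod_symm _ hρ.aemeasurable]
  simp only [Measure.restrict_univ]

theorem withDensity_comp_eq_self {μ : Measure X} {T : X → I} (hT : Measurable T)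
    [SigmaFinite (μ.map T)] {ρ : I → ℝ≥0∞} (hρ : Measurable ρ)
    (h : (μ.map T).withDensity ρ = μ.map T) : μ.withDensity (ρ ∘ T) = μ := by
  have hρ_one : ρ =ᵐ[μ.map T] 1 :=
    (withDensity_eq_iff_of_sigmaFinite hρ.aemeasurable aemeasurable_one).1
      (h.trans withDensity_one.symm)
  exact (withDensity_congr_ae (ae_of_ae_map hT.aemeasurable hρ_one)).trans withDensity_one

theorem absolutelyContinuous_prod_of_mem_couplings [Countable X] [MeasurableSingletonClass X]
    {μ ν : ProbabilityMeasure X} {γ : ProbabilityMeasure (X × X)} (hγ : γ ∈ couplings μ ν) :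
    (γ : Measure (X × X)) ≪ (μ : Measure X).prod (ν : Measure X) := by
  intro s hs
  refine (measure_null_iff_singleton s.to_countable).2 fun ⟨x, y⟩ hxy => ?_
  have hprod : (μ : Measure X) {x} * (ν : Measure X) {y} = 0 := by
    rw [← Measure.prod_prod, Set.singleton_prod_singleton]
    exact measure_mono_null (Set.singleton_subset_iff.2 hxy) hs
  rcases mul_eq_zero.1 hprod with hx | hy
  · rw [← hγ.1, Measure.map_apply measurable_fst (measurableSet_singleton x)] at hx
    exact measure_mono_null (by simp) hx
  · rw [← hγ.2, Measure.map_apply measurable_snd (measurableSet_singleton y)] at hy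
    exact measure_mono_null (by simp) hy

theorem exists_mem_couplings_map_eq [Countable I] [MeasurableSingletonClass I]
    {μ ν : ProbabilityMeasure X} {T : X → I} (hT : Measurable T) {κ : ProbabilityMeasure (I × I)}
    (hκ : κ ∈ couplings (μ.map hT.aemeasurable) (ν.map hT.aemeasurable)) :
    ∃ γ ∈ couplings μ ν, (γ : Measure (X × X)).map (Prod.map T T) = κ := by
  have := Measure.isProbabilityMeasure_map (μ := (μ : Measure X)) hT.aemeasurable
  have := Measure.isProbabilityMeasure_map (μ := (ν : Measure X)) hT.aemeasurable
  let π : Measure (I × I) := ((μ : Measure X).map T).prod ((ν : Measure X).map T)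
  let ρ : I × I → ℝ≥0∞ := (κ : Measure (I × I)).rnDeriv π
  have hρ : Measurable ρ := Measure.measurable_rnDeriv _ _
  have hTT : Measurable (Prod.map T T) := hT.prodMap hT
  have hπρ : π.withDensity ρ = κ :=
    Measure.withDensity_rnDeriv_eq _ _ (absolutelyContinuous_prod_of_mem_couplings hκ)
  let γ : Measure (X × X) :=
    ((μ : Measure X).prod (ν : Measure X)).withDensity (ρ ∘ Prod.map T T)
  have hγκ : γ.map (Prod.map T T) = κ := by
    rw [map_withDensity_comp _ hTT hρ, ← Measure.map_prod_map _ _ hT hT, hπρ]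
  have hγμ : γ.map Prod.fst = μ := by
    have hκμ : (κ : Measure (I × I)).map Prod.fst = (μ : Measure X).map T := hκ.1
    rw [← hπρ, map_fst_withDensity_prod _ _ hρ] at hκμ
    rw [map_fst_withDensity_prod _ _ (hρ.comp hTT)]
    convert withDensity_comp_eq_self hT hρ.lintegral_prod_right' hκμ using 2
    ext x
    exact (lintegral_map (hρ.comp measurable_prodMk_left) hT).symm
  have hγν : γ.map Prod.snd = ν := by
    have hκν : (κ : Measure (I × I)).map Prod.snd = (ν : Measure X).map T := hκ.2
    rw [← hπρ, map_snd_withDensity_prod _ _ hρ] at hκν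
    rw [map_snd_withDensity_prod _ _ (hρ.comp hTT)]
    convert withDensity_comp_eq_self hT hρ.lintegral_prod_left' hκν using 2
    ext x
    exact (lintegral_map (hρ.comp measurable_prodMk_right) hT).symm
  have hγ : IsProbabilityMeasure γ := ⟨by
    rw [← Set.preimage_univ (f := Prod.fst), ← Measure.map_apply measurable_fst .univ, hγμ,
      measure_univ]⟩
  exact ⟨⟨γ, hγ⟩, ⟨hγμ, hγν⟩, hγκ⟩

end Lift

/-! ### Optimal transport for continuous pseudometrics -/

section Couplings

variable {X : Type*} {k : X → X → ℝ} [MeasurableSpace X] {μ ν : ProbabilityMeasure X}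
  {γ : ProbabilityMeasure (X × X)}

theorem integral_fst_of_mem_couplings (hγ : γ ∈ couplings μ ν) {f : X → ℝ}
    (hf : AEStronglyMeasurable f (μ : Measure X)) :
    ∫ z, f z.1 ∂(γ : Measure (X × X)) = ∫ x, f x ∂(μ : Measure X) := by
  rw [← hγ.1] at hf ⊢
  exact (integral_map measurable_fst.aemeasurable hf).symm

theorem integral_snd_of_mem_couplings (hγ : γ ∈ couplings μ ν) {f : X → ℝ}
    (hf : AEStronglyMeasurable f (ν : Measure X)) :
    ∫ z, f z.2 ∂(γ : Measure (X × X)) = ∫ x, f x ∂(ν : Measure X) := by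
  rw [← hγ.2] at hf ⊢
  exact (integral_map measurable_snd.aemeasurable hf).symm

theorem couplings_nonempty (μ ν : ProbabilityMeasure X) : (couplings μ ν).Nonempty :=
  ⟨⟨(μ : Measure X).prod (ν : Measure X), inferInstance⟩, by constructor <;> simp⟩

theorem transportCost_le (hk : ∀ x y, 0 ≤ k x y) (hγ : γ ∈ couplings μ ν) :
    transportCost k μ ν ≤ ∫ z, k z.1 z.2 ∂(γ : Measure (X × X)) :=
  ciInf_le (f := fun γ : couplings μ ν => ∫ z, k z.1 z.2 ∂((γ : ProbabilityMeasure (X × X)) :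
    Measure (X × X)))
    ⟨0, Set.forall_mem_range.2 fun _ => integral_nonneg fun _ => hk _ _⟩ ⟨γ, hγ⟩

end Couplings

section Duality

variable {X ι : Type*} {k : X → X → ℝ} [TopologicalSpace X] [MeasurableSpace X] [BorelSpace X]

theorem IsContinuousPseudometric.integrable [SecondCountableTopology X]
    (hk : IsContinuousPseudometric k) (γ : Measure (X × X)) [IsFiniteMeasure γ] :
    Integrable (fun z : X × X => k z.1 z.2) γ :=
  .of_mem_Icc 0 1 hk.continuous.measurable.aemeasurable
    (.of_forall fun _ => ⟨hk.nonneg _ _, hk.le_one _ _⟩)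

theorem Nonexpansive.integral_sub_le_transportCost [SecondCountableTopology X] {h : X → ℝ}
    (hh : Nonexpansive k h) (hk : IsContinuousPseudometric k) (μ ν : ProbabilityMeasure X) :
    ∫ x, h x ∂(μ : Measure X) - ∫ x, h x ∂(ν : Measure X) ≤ transportCost k μ ν := by
  have := (couplings_nonempty μ ν).to_subtype
  refine le_ciInf fun ⟨γ, hγ⟩ => ?_
  have hfst : Integrable (fun z : X × X => h z.1) (γ : Measure (X × X)) :=
    Integrable.comp_measurable (hγ.1 ▸ hh.integrable hk μ) measurable_fst
  have hsnd : Integrable (fun z : X × X => h z.2) (γ : Measure (X × X)) :=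
    Integrable.comp_measurable (hγ.2 ▸ hh.integrable hk ν) measurable_snd
  rw [← integral_fst_of_mem_couplings hγ (hh.integrable hk μ).aestronglyMeasurable,
    ← integral_snd_of_mem_couplings hγ (hh.integrable hk ν).aestronglyMeasurable,
    ← integral_sub hfst hsnd]
  exact integral_mono (hfst.sub hsnd) (hk.integrable _) fun z => hh.sub_le _ _

section Quantization

variable [Finite ι] [Nonempty ι] [MeasurableSpace ι] [MeasurableSingletonClass ι] {a : ι → X}
  {T : X → ι} (hT : Measurable T)

include hT

theorem Nonexpansive.abs_integral_map_sub_integral_le {h : X → ℝ} (hh : Nonexpansive k h)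
    (hk : IsContinuousPseudometric k) (hTa : ∀ x, k x (a (T x)) = netDist k a x) (μ : Measure X)
    [IsFiniteMeasure μ] :
    |∫ i, h (a i) ∂(μ.map T) - ∫ x, h x ∂μ| ≤ ∫ x, netDist k a x ∂μ := by
  have hmap : Integrable (fun i => h (a i)) (μ.map T) := .of_finite
  have hcomp : Integrable (fun x => h (a (T x))) μ := hmap.comp_measurable hT
  rw [integral_map hT.aemeasurable hmap.aestronglyMeasurable,
    ← integral_sub hcomp (hh.integrable hk μ), ← Real.norm_eq_abs]
  refine norm_integral_le_of_norm_le ((hk.nonexpansive_netDist a).integrable hk μ)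
    (.of_forall fun x => ?_)
  rw [← hTa, hk.symm]
  exact hk.abs_sub_le hh _ _

theorem IsContinuousPseudometric.transportCost_le_of_mem_couplings_map
    [SecondCountableTopology X] (hk : IsContinuousPseudometric k)
    (hTa : ∀ x, k x (a (T x)) = netDist k a x) {μ ν : ProbabilityMeasure X}
    {κ : ProbabilityMeasure (ι × ι)}
    (hκ : κ ∈ couplings (μ.map hT.aemeasurable) (ν.map hT.aemeasurable)) :
    transportCost k μ ν ≤ ∫ x, netDist k a x ∂(μ : Measure X) +
      ∫ z, k (a z.1) (a z.2) ∂(κ : Measure (ι × ι)) + ∫ x, netDist k a x ∂(ν : Measure X) := by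
  obtain ⟨γ, hγ, hγκ⟩ := exists_mem_couplings_map_eq hT hκ
  have hnet (ρ : ProbabilityMeasure X) : Integrable (netDist k a) (ρ : Measure X) :=
    (hk.nonexpansive_netDist a).integrable hk _
  have hfst : Integrable (fun z : X × X => netDist k a z.1) (γ : Measure (X × X)) :=
    Integrable.comp_measurable (g := netDist k a) (by rw [hγ.1]; exact hnet μ) measurable_fst
  have hsnd : Integrable (fun z : X × X => netDist k a z.2) (γ : Measure (X × X)) :=
    Integrable.comp_measurable (g := netDist k a) (by rw [hγ.2]; exact hnet ν) measurable_snd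
  have hκint : Integrable (fun z : ι × ι => k (a z.1) (a z.2))
      ((γ : Measure (X × X)).map (Prod.map T T)) := .of_finite
  have hmid : Integrable (fun z : X × X => k (a (T z.1)) (a (T z.2))) (γ : Measure (X × X)) :=
    hκint.comp_measurable (hT.prodMap hT)
  have hsum : Integrable (fun z : X × X => netDist k a z.1 + k (a (T z.1)) (a (T z.2)))
      (γ : Measure (X × X)) := hfst.add hmid
  calc transportCost k μ ν
      ≤ ∫ z, k z.1 z.2 ∂(γ : Measure (X × X)) := transportCost_le hk.nonneg hγ
    _ ≤ ∫ z, (netDist k a z.1 + k (a (T z.1)) (a (T z.2)) + netDist k a z.2)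
          ∂(γ : Measure (X × X)) :=
        integral_mono (hk.integrable _) (hsum.add hsnd) fun z => by
          simp only [← hTa]
          linarith [hk.triangle z.1 (a (T z.1)) z.2, hk.triangle (a (T z.1)) (a (T z.2)) z.2,
            hk.symm (a (T z.2)) z.2]
    _ = _ := by
        rw [integral_add hsum hsnd, integral_add hfst hmid,
          integral_fst_of_mem_couplings hγ (hnet μ).aestronglyMeasurable,
          integral_snd_of_mem_couplings hγ (hnet ν).aestronglyMeasurable, ← hγκ,
          integral_map (hT.prodMap hT).aemeasurable hκint.aestronglyMeasurable]
        rfl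

end Quantization

variable [SecondCountableTopology X]

theorem IsContinuousPseudometric.transportCost_le_of_mcShane_le [Finite ι] [Nonempty ι]
    (hk : IsContinuousPseudometric k) (a : ι → X) {μ ν : ProbabilityMeasure X} {S : ℝ}
    (hS : ∀ v, ∫ x, mcShane k a v x ∂(μ : Measure X) - ∫ x, mcShane k a v x ∂(ν : Measure X) ≤ S) :
    transportCost k μ ν ≤
      S + 2 * (∫ x, netDist k a x ∂(μ : Measure X) + ∫ x, netDist k a x ∂(ν : Measure X)) := by
  have := Fintype.ofFinite ι
  let _ : LinearOrder ι := LinearOrder.lift' _ (Fintype.equivFin ι).injective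
  let _ : MeasurableSpace ι := ⊤
  obtain ⟨T, hT, hTa⟩ := exists_measurable_eq_iInf (F := fun i x => k x (a i))
    fun i => ((hk.nonexpansive (a i)).continuous hk).measurable
  obtain ⟨κ, hκ, hcost⟩ := (hk.comap a).exists_coupling_integral_le_of_finite
    (μ.map hT.aemeasurable) (ν.map hT.aemeasurable)
    (S := S + ∫ x, netDist k a x ∂(μ : Measure X) + ∫ x, netDist k a x ∂(ν : Measure X))
    fun f hf => by
      let v (i : ι) : unitInterval := ⟨f i, hf.nonneg i, hf.le_one i⟩
      have hv : (fun i => mcShane k a v (a i)) = f := funext (hk.mcShane_apply a (v := v) hf)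
      have habs (ρ : ProbabilityMeasure X) :=
        (hk.nonexpansive_mcShane a v).abs_integral_map_sub_integral_le hT hk hTa (ρ : Measure X)
      simp only [hv] at habs
      rw [ProbabilityMeasure.toMeasure_map, ProbabilityMeasure.toMeasure_map]
      linarith [abs_le.1 (habs μ), abs_le.1 (habs ν), hS v]
  linarith [hk.transportCost_le_of_mem_couplings_map hT hTa hκ]

theorem IsContinuousPseudometric.exists_transportCost_le_integral_sub_add
    (hk : IsContinuousPseudometric k) (μ ν : ProbabilityMeasure X) {ε : ℝ} (hε : 0 < ε) :
    ∃ h, Nonexpansive k h ∧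
      transportCost k μ ν ≤ ∫ x, h x ∂(μ : Measure X) - ∫ x, h x ∂(ν : Measure X) + ε := by
  have : Nonempty X := nonempty_of_isProbabilityMeasure (μ : Measure X)
  obtain ⟨n, a, ha⟩ := hk.exists_integral_netDist_lt ((μ : Measure X) + ν) (half_pos hε)
  have hnet := hk.nonexpansive_netDist a
  rw [integral_add_measure (hnet.integrable hk _) (hnet.integrable hk _)] at ha
  by_contra! hlt
  have hle := hk.transportCost_le_of_mcShane_le a (μ := μ) (ν := ν)
    (S := transportCost k μ ν - ε) fun v => by linarith [hlt _ (hk.nonexpansive_mcShane a v)]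
  linarith

theorem IsContinuousPseudometric.isPseudometric_transportCost (hk : IsContinuousPseudometric k) :
    IsPseudometric fun μ ν : ProbabilityMeasure X => transportCost k μ ν := by
  have hnonneg (μ ν : ProbabilityMeasure X) : 0 ≤ transportCost k μ ν :=
    Real.iInf_nonneg fun _ => integral_nonneg fun _ => hk.nonneg _ _
  have hsymm (μ ν : ProbabilityMeasure X) : transportCost k μ ν ≤ transportCost k ν μ := by
    refine le_of_forall_pos_le_add fun ε hε => ?_
    obtain ⟨h, hh, hle⟩ := hk.exists_transportCost_le_integral_sub_add μ ν hε
    have hcompl := (hh.one_sub hk.symm).integral_sub_le_transportCost hk ν μ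
    simp only [integral_sub (integrable_const 1) (hh.integrable hk _), integral_const,
      probReal_univ, one_smul] at hcompl
    linarith
  refine ⟨hnonneg, fun μ ν => ?_, fun μ => ?_, fun μ ν => (hsymm μ ν).antisymm (hsymm ν μ),
    fun μ ν ρ => ?_⟩
  · obtain ⟨γ, hγ⟩ := couplings_nonempty μ ν
    refine (transportCost_le hk.nonneg hγ).trans ?_
    simpa using integral_mono (hk.integrable (γ : Measure (X × X))) (integrable_const 1)
      fun z => hk.le_one z.1 z.2
  · refine (le_of_forall_pos_le_add fun ε hε => ?_).antisymm (hnonneg μ μ)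
    obtain ⟨h, -, hle⟩ := hk.exists_transportCost_le_integral_sub_add μ μ hε
    linarith
  · refine le_of_forall_pos_le_add fun ε hε => ?_
    obtain ⟨h, hh, hle⟩ := hk.exists_transportCost_le_integral_sub_add μ ρ hε
    linarith [hh.integral_sub_le_transportCost hk μ ν, hh.integral_sub_le_transportCost hk ν ρ]

theorem IsContinuousPseudometric.transportCost (hk : IsContinuousPseudometric k) :
    IsContinuousPseudometric fun μ ν : ProbabilityMeasure X => transportCost k μ ν := by
  have hW := hk.isPseudometric_transportCost
  refine hW.isContinuousPseudometric fun μ => tendsto_order.2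
    ⟨fun r hr => .of_forall fun ν => hr.trans_le (hW.nonneg μ ν), fun ε hε => ?_⟩
  have : Nonempty X := nonempty_of_isProbabilityMeasure (μ : Measure X)
  obtain ⟨n, a, ha⟩ := hk.exists_integral_netDist_lt (μ : Measure X) (ε := ε / 5) (by positivity)
  have hnet := ((hk.nonexpansive_netDist a).continuous_integral hk).tendsto μ
  have hpot : ∀ᶠ ν : ProbabilityMeasure X in 𝓝 μ, ∀ v ∈ Set.univ,
      ∫ x, mcShane k a v x ∂(μ : Measure X) - ∫ x, mcShane k a v x ∂(ν : Measure X) < ε / 5 := by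
    refine isCompact_univ.eventually_forall_of_forall_eventually fun v _ => ?_
    have hcont := hk.continuous_integral_mcShane a
    have hdiff := ((hcont.comp ((continuous_const (y := μ)).prodMk continuous_snd)).sub
      hcont).tendsto (μ, v)
    exact hdiff.eventually_lt_const (by simpa using hε)
  filter_upwards [hnet.eventually_lt_const ha, hpot] with ν hν hv
  linarith [hk.transportCost_le_of_mcShane_le a fun v => (hv v trivial).le]

end Duality

/-! ### Approximation in lattices of functions -/

section Lattice

variable {X ι : Type*} {A : Set (X → ℝ)} {h : X → ℝ} {ε : ℝ}

theorem exists_mem_forall_abs_sub_le [Finite ι] [Nonempty ι] (hsup : SupClosed A)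
    (hinf : InfClosed A) (a : ι → X)
    (hA : ∀ i j, ∃ g ∈ A, |g (a i) - h (a i)| ≤ ε ∧ |g (a j) - h (a j)| ≤ ε) :
    ∃ g ∈ A, ∀ i, |g (a i) - h (a i)| ≤ ε := by
  have := Fintype.ofFinite ι
  have hne : (Finset.univ : Finset ι).Nonempty := Finset.univ_nonempty
  choose g hgA hi hj using hA
  refine ⟨Finset.univ.sup' hne fun i => Finset.univ.inf' hne fun j => g i j,
    hsup.finsetSup'_mem hne fun i _ => hinf.finsetInf'_mem hne fun j _ => hgA i j, fun l => ?_⟩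
  simp only [Finset.sup'_apply, Finset.inf'_apply]
  refine abs_sub_le_iff.2 ⟨sub_le_iff_le_add.2 (Finset.sup'_le _ _ fun i _ => ?_),
    sub_le_comm.1 ?_⟩
  · exact (Finset.inf'_le _ (Finset.mem_univ l)).trans (by linarith [(abs_le.1 (hj i l)).2])
  · refine le_trans (Finset.le_inf' hne _ fun j _ => ?_)
      (Finset.le_sup' (fun i => Finset.univ.inf' hne fun j => g i j (a l)) (Finset.mem_univ l))
    linarith [(abs_le.1 (hi l j)).1]

variable {k : X → X → ℝ} [TopologicalSpace X] [SecondCountableTopology X] [MeasurableSpace X]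
  [BorelSpace X]

theorem IsContinuousPseudometric.exists_mem_integral_abs_sub_le (hk : IsContinuousPseudometric k)
    (hsup : SupClosed A) (hinf : InfClosed A) (hA : ∀ g ∈ A, Nonexpansive k g)
    (hh : Nonexpansive k h)
    (hAh : ∀ x y, ∀ δ > 0, ∃ g ∈ A, |g x - h x| ≤ δ ∧ |g y - h y| ≤ δ)
    (μ ν : ProbabilityMeasure X) (hε : 0 < ε) :
    ∃ g ∈ A, ∫ x, |g x - h x| ∂(μ : Measure X) + ∫ x, |g x - h x| ∂(ν : Measure X) ≤ ε := by
  have : Nonempty X := nonempty_of_isProbabilityMeasure (μ : Measure X)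
  obtain ⟨n, a, ha⟩ := hk.exists_integral_netDist_lt ((μ : Measure X) + ν) (ε := ε / 4)
    (by positivity)
  have hnet := hk.nonexpansive_netDist a
  rw [integral_add_measure (hnet.integrable hk _) (hnet.integrable hk _)] at ha
  obtain ⟨g, hgA, hg⟩ := exists_mem_forall_abs_sub_le hsup hinf a
    fun i j => hAh (a i) (a j) (ε / 4) (by positivity)
  refine ⟨g, hgA, ?_⟩
  linarith [hk.integral_abs_sub_le (μ : Measure X) (hA g hgA) hh hg,
    hk.integral_abs_sub_le (ν : Measure X) (hA g hgA) hh hg]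

end Lattice

/-! ### The discounted uniform pseudometric -/

theorem denseRange_nnratCast : DenseRange ((↑) : ℚ≥0 → ℝ≥0) := by
  have hsurj : Function.Surjective Real.toNNReal := fun t => ⟨t, Real.toNNReal_coe⟩
  refine (hsurj.denseRange.comp Rat.denseRange_cast continuous_real_toNNReal).mono ?_
  rintro _ ⟨q, rfl⟩
  exact ⟨q.toNNRat, NNReal.eq ((Rat.cast_max (K := ℝ) q 0).trans (by simp))⟩

section DiscUnif

variable {E : Type*} {c : ℝ} {m : E → E → ℝ}

theorem IsPseudometric.discount_mul_le_one (hm : IsPseudometric m) (hc₀ : 0 ≤ c) (hc₁ : c ≤ 1)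
    (x y : E) (t : ℝ≥0) : c ^ (t : ℝ) * m x y ≤ 1 :=
  mul_le_one₀ (Real.rpow_le_one hc₀ hc₁ t.2) (hm.nonneg _ _) (hm.le_one _ _)

variable [TopologicalSpace E]

theorem IsPseudometric.le_discUnif (hm : IsPseudometric m) (hc₀ : 0 ≤ c) (hc₁ : c ≤ 1)
    (ω ω' : Traj E) (t : ℝ≥0) : c ^ (t : ℝ) * m (ω t) (ω' t) ≤ discUnif c m ω ω' :=
  le_ciSup (f := fun t : ℝ≥0 => c ^ (t : ℝ) * m (ω t) (ω' t))
    ⟨1, Set.forall_mem_range.2 fun t => hm.discount_mul_le_one hc₀ hc₁ _ _ t⟩ t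

theorem IsPseudometric.discUnif (hm : IsPseudometric m) (hc₀ : 0 ≤ c) (hc₁ : c ≤ 1) :
    IsPseudometric (discUnif c m : Traj E → Traj E → ℝ) where
  nonneg ω ω' := Real.iSup_nonneg fun t => mul_nonneg (Real.rpow_nonneg hc₀ _) (hm.nonneg _ _)
  le_one ω ω' := ciSup_le fun t => hm.discount_mul_le_one hc₀ hc₁ _ _ t
  self ω := by simp [TrajMetric.discUnif, hm.self]
  symm ω ω' := by simp only [TrajMetric.discUnif, hm.symm]
  triangle ω₁ ω₂ ω₃ := ciSup_le fun t => by
    have h := mul_le_mul_of_nonneg_left (hm.triangle (ω₁ t) (ω₂ t) (ω₃ t))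
      (Real.rpow_nonneg hc₀ (t : ℝ))
    linarith [hm.le_discUnif hc₀ hc₁ ω₁ ω₂ t, hm.le_discUnif hc₀ hc₁ ω₂ ω₃ t]

theorem Nonexpansive.discount_mul_eval {f : E → ℝ} (hf : Nonexpansive m f)
    (hm : IsPseudometric m) (hc₀ : 0 ≤ c) (hc₁ : c ≤ 1) (t : ℝ≥0) :
    Nonexpansive (discUnif c m) fun ω : Traj E => c ^ (t : ℝ) * f (ω t) where
  sub_le ω ω' := by
    rw [← mul_sub]
    exact (mul_le_mul_of_nonneg_left (hf.sub_le _ _) (Real.rpow_nonneg hc₀ _)).trans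
      (hm.le_discUnif hc₀ hc₁ ω ω' t)
  nonneg ω := mul_nonneg (Real.rpow_nonneg hc₀ _) (hf.nonneg _)
  le_one ω := mul_le_one₀ (Real.rpow_le_one hc₀ hc₁ t.2) (hf.nonneg _) (hf.le_one _)

theorem discUnif_le_of_forall_le (hm : IsPseudometric m) (hc₀ : 0 ≤ c) (hc₁ : c ≤ 1) {r : ℝ}
    {N : ℕ} (hN : c ^ N ≤ r) {ω ω' : Traj E} (hr : ∀ t ≤ (N : ℝ≥0), m (ω t) (ω' t) ≤ r) :
    discUnif c m ω ω' ≤ r := by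
  refine ciSup_le fun t => ?_
  rcases le_total t N with ht | ht
  · exact (mul_le_of_le_one_left (hm.nonneg _ _) (Real.rpow_le_one hc₀ hc₁ t.2)).trans (hr t ht)
  · calc c ^ (t : ℝ) * m (ω t) (ω' t)
        ≤ c ^ (t : ℝ) := mul_le_of_le_one_right (Real.rpow_nonneg hc₀ _) (hm.le_one _ _)
      _ ≤ c ^ (N : ℝ) :=
        Real.rpow_le_rpow_of_exponent_ge' hc₀ hc₁ N.cast_nonneg (by exact_mod_cast ht)
      _ ≤ r := by rwa [Real.rpow_natCast]

theorem IsContinuousPseudometric.discUnif (hm : IsContinuousPseudometric m) (hc₀ : 0 ≤ c)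
    (hc₁ : c < 1) : IsContinuousPseudometric (discUnif c m : Traj E → Traj E → ℝ) := by
  have hU := hm.toIsPseudometric.discUnif hc₀ hc₁.le
  refine hU.isContinuousPseudometric fun ω => tendsto_order.2
    ⟨fun r hr => .of_forall fun ω' => hr.trans_le (hU.nonneg ω ω'), fun r hr => ?_⟩
  obtain ⟨N, hN⟩ := exists_pow_lt_of_lt_one (half_pos hr) hc₁
  have hunif : ∀ᶠ ω' in 𝓝 ω, ∀ t ∈ Set.Icc (0 : ℝ≥0) N, m (ω t) (ω' t) < r / 2 := by
    refine isCompact_Icc.eventually_forall_of_forall_eventually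
      (P := fun (ω' : Traj E) t => m (ω t) (ω' t) < r / 2) fun t _ => ?_
    have hcont : Continuous fun z : Traj E × ℝ≥0 => m (ω z.2) (z.1 z.2) :=
      hm.continuous.comp ((ω.continuous.comp continuous_snd).prodMk continuous_eval)
    exact (hcont.tendsto (ω, t)).eventually_lt_const (by simpa [hm.self] using half_pos hr)
  filter_upwards [hunif] with ω' hω'
  exact (discUnif_le_of_forall_le hm.toIsPseudometric hc₀ hc₁.le hN.le
    fun t ht => (hω' t ⟨zero_le, ht⟩).le).trans_lt (half_lt_self hr)

theorem IsContinuousPseudometric.exists_nnrat_lt_of_lt_discUnif (hm : IsContinuousPseudometric m)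
    (hc₀ : 0 < c) {ω ω' : Traj E} {r : ℝ} (hr : r < TrajMetric.discUnif c m ω ω') :
    ∃ q : ℚ≥0, r < c ^ (q : ℝ) * m (ω (q : ℝ≥0)) (ω' (q : ℝ≥0)) := by
  obtain ⟨t, ht⟩ := exists_lt_of_lt_ciSup hr
  have hcont : Continuous fun t : ℝ≥0 => c ^ (t : ℝ) * m (ω t) (ω' t) :=
    (continuous_const.rpow NNReal.continuous_coe fun _ => .inl hc₀.ne').mul
      (hm.continuous.comp (ω.continuous.prodMk ω'.continuous))
  exact denseRange_nnratCast.exists_mem_open (isOpen_lt continuous_const hcont) ⟨t, ht⟩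

end DiscUnif

/-! ### The iterated pseudometrics of a diffusion -/

theorem isContinuousPseudometric_abs_sub {X : Type*} [TopologicalSpace X] {f : X → ℝ}
    (hf : Continuous f) (hf01 : ∀ x, 0 ≤ f x ∧ f x ≤ 1) :
    IsContinuousPseudometric fun x y => |f x - f y| where
  nonneg _ _ := abs_nonneg _
  le_one x y := abs_sub_le_of_nonneg_of_le (hf01 x).1 (hf01 x).2 (hf01 y).1 (hf01 y).2
  self x := by simp
  symm x y := abs_sub_comm _ _
  triangle x y z := _root_.abs_sub_le _ _ _
  continuous := ((hf.comp continuous_fst).sub (hf.comp continuous_snd)).abs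

namespace Diffusion

variable {E : Type*} [TopologicalSpace E] [LocallyCompactSpace E] [T2Space E]
  [SecondCountableTopology E] [MeasurableSpace E] [BorelSpace E] (D : Diffusion E)
  {obs : E → ℝ} {c : ℝ} {m : E → E → ℝ}

theorem ae_law_eval_zero (x : E) : ∀ᵐ ω ∂(D.law x : Measure (Traj E)), ω 0 = x := by
  have hmass := D.law_cylinder x {x} [] (measurableSet_singleton x) (by simp) .nil
  refine (prob_compl_eq_zero_iff (Traj.measurable_eval 0 (measurableSet_singleton x))).2 ?_
  simpa [FDSemigroup.cylinderMass, Set.preimage] using hmass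

theorem integral_law_eval_zero (f : E → ℝ) (x : E) :
    ∫ ω, f (ω 0) ∂(D.law x : Measure (Traj E)) = f x := by
  rw [integral_congr_ae ((D.ae_law_eval_zero x).mono fun ω hω => congrArg f hω)]
  simp

theorem nonexpansive_integral_law (hm : IsContinuousPseudometric m) (hc₀ : 0 ≤ c) (hc₁ : c < 1)
    {g : Traj E → ℝ} (hg : Nonexpansive (discUnif c m) g) :
    Nonexpansive (D.functionalG c m) fun x => ∫ ω, g ω ∂(D.law x : Measure (Traj E)) where
  sub_le x y := hg.integral_sub_le_transportCost (hm.discUnif hc₀ hc₁) _ _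
  nonneg x := integral_nonneg hg.nonneg
  le_one x := by
    simpa using integral_mono (hg.integrable (hm.discUnif hc₀ hc₁) (D.law x : Measure (Traj E)))
      (integrable_const 1) hg.le_one

theorem nonexpansive_functionalG (hm : IsContinuousPseudometric m) (hc₀ : 0 ≤ c) (hc₁ : c < 1)
    {f : E → ℝ} (hf : Nonexpansive m f) : Nonexpansive (D.functionalG c m) f := by
  have hf₀ : Nonexpansive (discUnif c m) fun ω : Traj E => f (ω 0) := by
    simpa using hf.discount_mul_eval hm.toIsPseudometric hc₀ hc₁.le 0
  simpa only [D.integral_law_eval_zero] using D.nonexpansive_integral_law hm hc₀ hc₁ hf₀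

theorem isContinuousPseudometric_functionalG (hm : IsContinuousPseudometric m) (hc₀ : 0 ≤ c)
    (hc₁ : c < 1) : IsContinuousPseudometric (D.functionalG c m) where
  toIsPseudometric := (hm.discUnif hc₀ hc₁).transportCost.comap D.law
  continuous := (hm.discUnif hc₀ hc₁).transportCost.continuous.comp
    (D.continuous_law.prodMap D.continuous_law)

theorem isContinuousPseudometric_iterDist (hobs : Continuous obs)
    (hobs01 : ∀ x, 0 ≤ obs x ∧ obs x ≤ 1) (hc₀ : 0 ≤ c) (hc₁ : c < 1) (n : ℕ) :
    IsContinuousPseudometric (D.iterDist obs c n) := by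
  induction n with
  | zero => exact isContinuousPseudometric_abs_sub hobs hobs01
  | succ n ih => exact D.isContinuousPseudometric_functionalG ih hc₀ hc₁

theorem nonexpansive_obs (hobs : Continuous obs) (hobs01 : ∀ x, 0 ≤ obs x ∧ obs x ≤ 1)
    (hc₀ : 0 ≤ c) (hc₁ : c < 1) (n : ℕ) : Nonexpansive (D.iterDist obs c n) obs := by
  induction n with
  | zero => exact ⟨fun _ _ => le_abs_self _, fun x => (hobs01 x).1, fun x => (hobs01 x).2⟩
  | succ n ih =>
    exact D.nonexpansive_functionalG (D.isContinuousPseudometric_iterDist hobs hobs01 hc₀ hc₁ n)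
      hc₀ hc₁ ih

/-! ### Expressions are nonexpansive -/

/-- The pseudometric that `dₙ` gives on the domain of either sort: `dₙ` on states and `U_c(dₙ)` on
trajectories. -/
noncomputable def iterDistOn (obs : E → ℝ) (c : ℝ) (n : ℕ) :
    (s : LogicSort) → Domain E s → Domain E s → ℝ
  | .state => D.iterDist obs c n
  | .traj => discUnif c (D.iterDist obs c n)

theorem isPseudometric_iterDistOn (hobs : Continuous obs) (hobs01 : ∀ x, 0 ≤ obs x ∧ obs x ≤ 1)
    (hc₀ : 0 ≤ c) (hc₁ : c < 1) (n : ℕ) :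
    ∀ s, IsPseudometric (D.iterDistOn obs c n s)
  | .state => (D.isContinuousPseudometric_iterDist hobs hobs01 hc₀ hc₁ n).toIsPseudometric
  | .traj =>
    (D.isContinuousPseudometric_iterDist hobs hobs01 hc₀ hc₁ n).toIsPseudometric.discUnif hc₀
      hc₁.le

theorem eventually_nonexpansive_interp (hobs : Continuous obs)
    (hobs01 : ∀ x, 0 ≤ obs x ∧ obs x ≤ 1) (hc₀ : 0 ≤ c) (hc₁ : c < 1) {s : LogicSort}
    (e : LogicExpr s) :
    ∀ᶠ n in atTop, Nonexpansive (D.iterDistOn obs c n s) (D.interp obs c e) := by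
  have hd := D.isContinuousPseudometric_iterDist hobs hobs01 hc₀ hc₁
  have hdOn := D.isPseudometric_iterDistOn hobs hobs01 hc₀ hc₁
  induction e with
  | const q =>
    exact .of_forall fun n => .const (q := ((q : ℚ) : ℝ)) (hdOn n .state).nonneg
      (mod_cast q.2.1) (mod_cast q.2.2)
  | obs => exact .of_forall (D.nonexpansive_obs hobs hobs01 hc₀ hc₁)
  | compl f ih => exact ih.mono fun n hf => hf.one_sub (hdOn n .state).symm
  | integral g ih =>
    rw [← map_add_atTop_eq_nat 1, eventually_map]
    exact ih.mono fun n hg => D.nonexpansive_integral_law (hd n) hc₀ hc₁ hg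
  | ev f t ih =>
    exact ih.mono fun n hf => hf.discount_mul_eval (hd n).toIsPseudometric hc₀ hc₁.le t
  | min g₁ g₂ ih₁ ih₂ => exact (ih₁.and ih₂).mono fun n hg => hg.1.inf hg.2
  | max g₁ g₂ ih₁ ih₂ => exact (ih₁.and ih₂).mono fun n hg => hg.1.sup hg.2
  | minus g q ih =>
    exact ih.mono fun n hg => hg.truncSub (hdOn n .traj).nonneg (mod_cast q.2.1)
  | plus g q ih =>
    exact ih.mono fun n hg => hg.truncAdd (hdOn n .traj).nonneg (mod_cast q.2.1)

end Diffusion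

/-! ### Expressions attain the iterated pseudometrics -/

theorem exists_rat_unitInterval_between {x ε : ℝ} (hx₀ : 0 ≤ x) (hx₁ : x ≤ 1) (hε : 0 < ε) :
    ∃ q : Set.Icc (0 : ℚ) 1, x - ε ≤ (q : ℚ) ∧ ((q : ℚ) : ℝ) ≤ x := by
  obtain ⟨q, hxq, hqx⟩ := exists_rat_btwn (sub_lt_self x hε)
  refine ⟨⟨max 0 q, le_max_left _ _, max_le zero_le_one (mod_cast (hqx.trans_le hx₁).le)⟩, ?_, ?_⟩
  · push_cast
    exact le_max_of_le_right hxq.le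
  · push_cast
    exact max_le hx₀ hqx.le

theorem exists_rat_truncation_near {u v s t ε : ℝ} (hε : 0 < ε) (hv₀ : 0 ≤ v) (hv₁ : v ≤ 1)
    (ht : 0 ≤ t) (hts : t ≤ s) (hs : s ≤ 1) (hgap : s - t - ε / 2 ≤ u - v) :
    ∃ q₁ q₂ q₃ : Set.Icc (0 : ℚ) 1,
      |min 1 (min (max 0 (u - (q₁ : ℚ))) (q₂ : ℚ) + (q₃ : ℚ)) - s| ≤ ε ∧
      |min 1 (min (max 0 (v - (q₁ : ℚ))) (q₂ : ℚ) + (q₃ : ℚ)) - t| ≤ ε := by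
  -- Shift `v` to `0`, cut off at `s - t` and shift back by `t`.
  obtain ⟨q₁, hq₁, hq₁'⟩ := exists_rat_unitInterval_between hv₀ hv₁ (half_pos hε)
  obtain ⟨q₂, hq₂, hq₂'⟩ :=
    exists_rat_unitInterval_between (sub_nonneg.2 hts) (by linarith) (half_pos hε)
  obtain ⟨q₃, hq₃, hq₃'⟩ := exists_rat_unitInterval_between ht (hts.trans hs) (half_pos hε)
  refine ⟨q₁, q₂, q₃, ?_⟩
  have hcap (a : ℝ) : min 1 (min (max 0 (a - (q₁ : ℚ))) (q₂ : ℚ) + (q₃ : ℚ)) =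
      min (max 0 (a - (q₁ : ℚ))) (q₂ : ℚ) + (q₃ : ℚ) :=
    min_eq_right (by linarith [min_le_right (max 0 (a - (q₁ : ℚ))) ((q₂ : ℚ) : ℝ)])
  rw [hcap, hcap]
  have hq₂₀ : (0 : ℝ) ≤ (q₂ : ℚ) := mod_cast q₂.2.1
  have hu_le := min_le_right (max 0 (u - (q₁ : ℚ))) ((q₂ : ℚ) : ℝ)
  have hu_ge : s - t - ε / 2 ≤ min (max 0 (u - (q₁ : ℚ))) ((q₂ : ℚ) : ℝ) :=
    le_min (le_max_of_le_right (by linarith)) hq₂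
  have hv_le : min (max 0 (v - (q₁ : ℚ))) ((q₂ : ℚ) : ℝ) ≤ ε / 2 :=
    (min_le_left _ _).trans (max_le (half_pos hε).le (by linarith))
  have hv_ge : 0 ≤ min (max 0 (v - (q₁ : ℚ))) ((q₂ : ℚ) : ℝ) := le_min (le_max_left _ _) hq₂₀
  constructor <;> rw [abs_sub_le_iff] <;> constructor <;> linarith

namespace Diffusion

variable {E : Type*} [TopologicalSpace E] [LocallyCompactSpace E] [T2Space E]
  [SecondCountableTopology E] [MeasurableSpace E] [BorelSpace E] {D : Diffusion E}
  {obs : E → ℝ} {c : ℝ} {m : E → E → ℝ}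

/-- `k` is the supremum of the differences `e x - e y` over the expressions `e` of sort `s` that
are nonexpansive for `k`. -/
def IsExpressible (D : Diffusion E) (obs : E → ℝ) (c : ℝ) (s : LogicSort)
    (k : Domain E s → Domain E s → ℝ) : Prop :=
  ∀ x y, ∀ ε > 0, ∃ e : LogicExpr s, Nonexpansive k (D.interp obs c e) ∧
    k x y - ε ≤ D.interp obs c e x - D.interp obs c e y

namespace IsExpressible

theorem discUnif (hexpr : D.IsExpressible obs c .state m) (hm : IsContinuousPseudometric m)
    (hc₀ : 0 < c) (hc₁ : c ≤ 1) : D.IsExpressible obs c .traj (discUnif c m) := by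
  intro ω ω' ε hε
  obtain ⟨q, hq⟩ := hm.exists_nnrat_lt_of_lt_discUnif hc₀
    (sub_lt_self (TrajMetric.discUnif c m ω ω') (half_pos hε))
  obtain ⟨f, hf, hle⟩ := hexpr (ω (q : ℝ≥0)) (ω' (q : ℝ≥0)) (ε / 2) (half_pos hε)
  refine ⟨.ev f q, hf.discount_mul_eval hm.toIsPseudometric hc₀.le hc₁ q, ?_⟩
  have hmul := mul_le_mul_of_nonneg_left hle (Real.rpow_nonneg hc₀.le (q : ℝ))
  have hdisc : c ^ (q : ℝ) * (ε / 2) ≤ ε / 2 :=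
    mul_le_of_le_one_left (half_pos hε).le (Real.rpow_le_one hc₀.le hc₁ q.cast_nonneg)
  rw [mul_sub, mul_sub] at hmul
  simp only [interp]
  linarith

theorem exists_interp_near {k : Traj E → Traj E → ℝ} (hexpr : D.IsExpressible obs c .traj k)
    (hk : IsPseudometric k) {h : Traj E → ℝ} (hh : Nonexpansive k h) (ω ω' : Traj E) {ε : ℝ}
    (hε : 0 < ε) :
    ∃ g : LogicExpr .traj, Nonexpansive k (D.interp obs c g) ∧
      |D.interp obs c g ω - h ω| ≤ ε ∧ |D.interp obs c g ω' - h ω'| ≤ ε := by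
  wlog hle : h ω' ≤ h ω generalizing ω ω'
  · obtain ⟨g, hg, hω', hω⟩ := this ω' ω (le_of_not_ge hle)
    exact ⟨g, hg, hω, hω'⟩
  obtain ⟨g, hg, hsep⟩ := hexpr ω ω' (ε / 2) (half_pos hε)
  obtain ⟨q₁, q₂, q₃, hω, hω'⟩ := exists_rat_truncation_near (u := D.interp obs c g ω) hε
    (hg.nonneg ω') (hg.le_one ω') (hh.nonneg ω') hle (hh.le_one ω) (by linarith [hh.sub_le ω ω'])
  have hconst : Nonexpansive k (D.interp obs c (.ev (.const q₂) 0)) := by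
    simpa [interp] using Nonexpansive.const (q := ((q₂ : ℚ) : ℝ)) hk.nonneg (mod_cast q₂.2.1)
      (mod_cast q₂.2.2)
  refine ⟨.plus (.min (.minus g q₁) (.ev (.const q₂) 0)) q₃,
    ((hg.truncSub hk.nonneg (mod_cast q₁.2.1)).inf hconst).truncAdd hk.nonneg
      (mod_cast q₃.2.1), ?_⟩
  simpa only [interp, NNRat.cast_zero, Real.rpow_zero, one_mul] using And.intro hω hω'

theorem functionalG (hexpr : D.IsExpressible obs c .state m) (hm : IsContinuousPseudometric m)
    (hc₀ : 0 < c) (hc₁ : c < 1) : D.IsExpressible obs c .state (D.functionalG c m) := by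
  intro x y ε hε
  have hU := hm.discUnif hc₀.le hc₁
  obtain ⟨h, hh, hdual⟩ :=
    hU.exists_transportCost_le_integral_sub_add (D.law x) (D.law y) (half_pos hε)
  obtain ⟨_, ⟨g, hg, rfl⟩, happrox⟩ := hU.exists_mem_integral_abs_sub_le (ε := ε / 2)
    (A := {F | ∃ g : LogicExpr .traj, Nonexpansive (TrajMetric.discUnif c m) (D.interp obs c g) ∧
      D.interp obs c g = F})
    (by rintro _ ⟨g₁, h₁, rfl⟩ _ ⟨g₂, h₂, rfl⟩; exact ⟨.max g₁ g₂, h₁.sup h₂, rfl⟩)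
    (by rintro _ ⟨g₁, h₁, rfl⟩ _ ⟨g₂, h₂, rfl⟩; exact ⟨.min g₁ g₂, h₁.inf h₂, rfl⟩)
    (by rintro _ ⟨g, hg, rfl⟩; exact hg) hh
    (fun ω ω' δ hδ => by
      obtain ⟨g, hg, hgh⟩ := (hexpr.discUnif hm hc₀ hc₁.le).exists_interp_near
        hU.toIsPseudometric hh ω ω' hδ
      exact ⟨_, ⟨g, hg, rfl⟩, hgh⟩)
    (D.law x) (D.law y) (half_pos hε)
  refine ⟨.integral g, D.nonexpansive_integral_law hm hc₀.le hc₁ hg, ?_⟩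
  have hint (z : E) : |∫ ω, D.interp obs c g ω ∂(D.law z : Measure (Traj E)) -
      ∫ ω, h ω ∂(D.law z : Measure (Traj E))| ≤
      ∫ ω, |D.interp obs c g ω - h ω| ∂(D.law z : Measure (Traj E)) := by
    rw [← integral_sub (hg.integrable hU _) (hh.integrable hU _)]
    exact abs_integral_le_integral_abs
  simp only [interp, Diffusion.functionalG]
  linarith [abs_le.1 (hint x), abs_le.1 (hint y)]

end IsExpressible

variable (D)

theorem isExpressible_iterDist (hobs : Continuous obs) (hobs01 : ∀ x, 0 ≤ obs x ∧ obs x ≤ 1)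
    (hc₀ : 0 < c) (hc₁ : c < 1) (n : ℕ) : D.IsExpressible obs c .state (D.iterDist obs c n) := by
  have hd := D.isContinuousPseudometric_iterDist hobs hobs01 hc₀.le hc₁
  induction n with
  | zero =>
    intro x y ε hε
    have hne := D.nonexpansive_obs hobs hobs01 hc₀.le hc₁ 0
    rcases le_total (obs y) (obs x) with hle | hle
    · refine ⟨.obs, hne, ?_⟩
      simp only [iterDist, interp, abs_of_nonneg (sub_nonneg.2 hle)]
      linarith
    · refine ⟨.compl .obs, hne.one_sub (hd 0).symm, ?_⟩
      simp only [iterDist, interp, abs_of_nonpos (sub_nonpos.2 hle)]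
      linarith
  | succ n ih => exact ih.functionalG (hd n) hc₀ hc₁

theorem abs_interp_sub_le_fixDist (hobs : Continuous obs) (hobs01 : ∀ x, 0 ≤ obs x ∧ obs x ≤ 1)
    (hc₀ : 0 ≤ c) (hc₁ : c < 1) (f : LogicExpr .state) (x y : E) :
    |D.interp obs c f x - D.interp obs c f y| ≤ D.fixDist obs c x y := by
  have hd := D.isContinuousPseudometric_iterDist hobs hobs01 hc₀ hc₁
  obtain ⟨n, hf⟩ := (D.eventually_nonexpansive_interp hobs hobs01 hc₀ hc₁ f).exists
  exact ((hd n).abs_sub_le hf x y).trans <| le_ciSup (f := fun n => D.iterDist obs c n x y)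
    ⟨1, Set.forall_mem_range.2 fun n => (hd n).le_one x y⟩ n

theorem iterDist_le_logicDist (hobs : Continuous obs) (hobs01 : ∀ x, 0 ≤ obs x ∧ obs x ≤ 1)
    (hc₀ : 0 < c) (hc₁ : c < 1) (n : ℕ) (x y : E) :
    D.iterDist obs c n x y ≤ D.logicDist obs c x y := by
  refine le_of_forall_pos_le_add fun ε hε => ?_
  obtain ⟨f, -, hf⟩ := D.isExpressible_iterDist hobs hobs01 hc₀ hc₁ n x y ε hε
  have hle : |D.interp obs c f x - D.interp obs c f y| ≤ D.logicDist obs c x y :=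
    le_ciSup (f := fun f : LogicExpr .state => |D.interp obs c f x - D.interp obs c f y|)
      ⟨D.fixDist obs c x y, Set.forall_mem_range.2 fun f =>
        D.abs_interp_sub_le_fixDist hobs hobs01 hc₀.le hc₁ f x y⟩ f
  linarith [le_abs_self (D.interp obs c f x - D.interp obs c f y)]

end Diffusion

end TrajMetric

theorem mainTheorem4 {E : Type*} [TopologicalSpace E] [LocallyCompactSpace E] [T2Space E]
    [SecondCountableTopology E] [MeasurableSpace E] [BorelSpace E]
    (D : TrajMetric.Diffusion E) (obs : E → ℝ) (hobs : Continuous obs)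
    (hobs01 : ∀ x, 0 ≤ obs x ∧ obs x ≤ 1) (c : ℝ) (hc0 : 0 < c) (hc1 : c < 1) :
    (∀ n, TrajMetric.IsPseudometric (D.iterDist obs c n) ∧
      Continuous fun p : E × E => D.iterDist obs c n p.1 p.2) ∧
    ∀ x y, D.logicDist obs c x y = D.fixDist obs c x y := by
  have : Nonempty (TrajMetric.LogicExpr .state) := ⟨.obs⟩
  refine ⟨fun n => ?_, fun x y => le_antisymm ?_ ?_⟩
  · have hd := D.isContinuousPseudometric_iterDist hobs hobs01 hc0.le hc1 n
    exact ⟨hd.toIsPseudometric, hd.continuous⟩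
  · exact ciSup_le fun f => D.abs_interp_sub_le_fixDist hobs hobs01 hc0.le hc1 f x y
  · exact ciSup_le fun n => D.iterDist_le_logicDist hobs hobs01 hc0 hc1 n x y
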